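/- Let $f:\mathbb R^2\to[0,\infty)$ be a surface tension, i.e. convex, positively $1$-homogeneous and positive on $S^1$, and suppose $f$ is crystalline: there is a finite set $\{x_1,\dots,x_N\}\subset\mathbb R^2\setminus\{0\}$ with $f(\nu)=\max_j x_j\cdot\nu$ for all $\nu\in S^1$. Let $K=\bigcap_{\nu\in S^1}\{x: x\cdot\nu<f(\nu)\}$ be its Wulff shape and $f_*(x)=\sup\{x\cdot\nu: f(\nu)\le 1\}$ its gauge function. For a set $E$ of finite perimeter with $0<|E|<\infty$, with reduced boundary $\partial^*E$ and measure-theoretic outer unit normal $\nu_E$, put $$\Phi(E)=\int_{\partial^*E}f(\nu_E)\,d\mathcal H^1,\qquad \delta_\Phi(E)=\frac{\Phi(E)}{2|K|^{1/2}|E|^{1/2}}-1,$$ $$\beta_\Phi(E)=\inf_{y\in\mathbb R^2}\Big(\frac{1}{2|K|^{1/2}|E|^{1/2}}\int_{\partial^*E}f(\nu_E(x))-\nu_E(x)\cdot\frac{x-y}{f_*(x-y)}\,d\mathcal H^1(x)\Big)^{1/2}$$ (the infimum is attained). Proposition 5.1. There is a constant $C>0$, depending only on $f$, such that $$\beta_\Phi(E)^2\le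 C\,\delta_\Phi(E)$$ for every $E\subset\mathbb R^2$ that is parallel to $K$ (that is, $E$ is an open convex polygon and the set $\{\nu_E(x):x\in\partial^*E\}$ of its outer unit normals equals that of $K$) and satisfies $|E|=|K|$ and $|E\Delta K|=\inf\{|E\Delta(K+y)|:y\in\mathbb R^2\}$. -/

import Mathlib

open MeasureTheory Set Filter Topology
open scoped ENNReal

noncomputable section

namespace Wulff

/-- The Euclidean plane. -/
abbrev Plane : Type := EuclideanSpace ℝ (Fin 2)

/-- A surface tension: a nonnegative, convex, positively one-homogeneous function that is
positive on the unit circle. -/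
structure IsSurfaceTension (f : Plane → ℝ) : Prop where
  nonneg : ∀ ν, 0 ≤ f ν
  convexOn : ConvexOn ℝ univ f
  homogeneous : ∀ (t : ℝ) (ν : Plane), 0 < t → f (t • ν) = t * f ν
  pos_on_sphere : ∀ ν : Plane, ‖ν‖ = 1 → 0 < f ν

/-- `f` is crystalline: on the unit circle it is the maximum of finitely many linear functions
`ν ↦ x_j · ν` with nonzero `x_j`. -/
def IsCrystalline (f : Plane → ℝ) : Prop :=
  ∃ s : Finset Plane, (∀ x ∈ s, x ≠ 0) ∧
    ∀ ν : Plane, ‖ν‖ = 1 → IsGreatest ((fun x : Plane => inner ℝ x ν) '' (s : Set Plane)) (f ν)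

/-- The Wulff shape `K = ⋂_{|ν| = 1} {x : x · ν < f ν}`. -/
def wulffShape (f : Plane → ℝ) : Set Plane :=
  {x | ∀ ν : Plane, ‖ν‖ = 1 → inner ℝ x ν < f ν}

/-- The gauge function `f_*(x) = sup {x · ν : f ν ≤ 1}`. -/
def gaugeFn (f : Plane → ℝ) (x : Plane) : ℝ :=
  sSup ((fun ν : Plane => inner ℝ x ν) '' {ν | f ν ≤ 1})

/-- `μ` is the distributional gradient `Dχ_E` of the characteristic function of `E`, and it is a
vector-valued Borel measure of finite total variation. -/
def IsIndicatorGradient (E : Set Plane) (μ : VectorMeasure Plane Plane) : Prop :=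
  μ.variation univ < ∞ ∧
    ∀ φ : Plane → ℝ, ContDiff ℝ 1 φ → HasCompactSupport φ →
      ∫ x in E, gradient φ x = -μ.integral φ (ContinuousLinearMap.lsmul ℝ ℝ)

/-- `ν` is the measure theoretic outer unit normal of `E` at `x` (De Giorgi): `|Dχ_E|` charges
every ball centred at `x`, and `Dχ_E (B_r(x)) / |Dχ_E| (B_r(x)) → -ν` as `r → 0⁺`, `|ν| = 1`. -/
def HasOuterNormalAt (E : Set Plane) (x ν : Plane) : Prop :=
  ∃ μ : VectorMeasure Plane Plane, IsIndicatorGradient E μ ∧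
    (∀ r : ℝ, 0 < r → 0 < μ.variation (Metric.ball x r)) ∧ ‖ν‖ = 1 ∧
    Tendsto (fun r : ℝ => (μ.variation.real (Metric.ball x r))⁻¹ • μ (Metric.ball x r))
      (𝓝[>] 0) (𝓝 (-ν))

/-- The reduced boundary `∂*E`. -/
def reducedBoundary (E : Set Plane) : Set Plane :=
  {x | ∃ ν, HasOuterNormalAt E x ν}

open Classical in
/-- The measure theoretic outer unit normal `ν_E` on `∂*E` (extended by `0`). -/
def outerNormal (E : Set Plane) (x : Plane) : Plane :=
  if h : ∃ ν, HasOuterNormalAt E x ν then h.choose else 0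

/-- The surface energy `Φ(E) = ∫_{∂*E} f(ν_E) dℋ¹`. -/
def surfaceEnergy (f : Plane → ℝ) (E : Set Plane) : ℝ :=
  ∫ x in reducedBoundary E, f (outerNormal E x) ∂μH[1]

/-- The normalizing factor `n |K|^{1/n} |E|^{1/n'}` in dimension `n = 2`. -/
def normalization (f : Plane → ℝ) (E : Set Plane) : ℝ :=
  2 * √(volume.real (wulffShape f)) * √(volume.real E)

/-- The anisotropic isoperimetric deficit `δ_Φ(E)`. -/
def deficit (f : Plane → ℝ) (E : Set Plane) : ℝ :=
  surfaceEnergy f E / normalization f E - 1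

/-- The `Φ`-oscillation index `β_Φ(E)`. -/
def oscillationIndex (f : Plane → ℝ) (E : Set Plane) : ℝ :=
  ⨅ y : Plane, √((1 / normalization f E) *
    ∫ x in reducedBoundary E,
      (f (outerNormal E x) - inner ℝ (outerNormal E x) ((gaugeFn f (x - y))⁻¹ • (x - y))) ∂μH[1])

/-- Open convex polygons: nonempty bounded finite intersections of open half-planes. -/
def IsOpenConvexPolygon (E : Set Plane) : Prop :=
  E.Nonempty ∧ Bornology.IsBounded E ∧
    ∃ s : Finset (Plane × ℝ), (∀ p ∈ s, p.1 ≠ 0) ∧ E = {x | ∀ p ∈ s, inner ℝ x p.1 < p.2}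

/-- The set of outer unit normals `{ν_E} = {ν_E(x) : x ∈ ∂*E}`. -/
def normals (E : Set Plane) : Set Plane :=
  outerNormal E '' reducedBoundary E

/-- `E` is parallel to `K`: an open convex polygon with exactly the same outer unit normals. -/
def IsParallelTo (E K : Set Plane) : Prop :=
  IsOpenConvexPolygon E ∧ normals E = normals K

end Wulff

end

noncomputable section

namespace Wulff

/-! ### Planar vector algebra -/

/-! A polygon `E` parallel to `K` is determined by its support numbers `h` on the common finite set
`N` of normals; those of `K` are `f` itself. Edge lengths are linear in `h`, so 2|E| and Φ(E) are
V(h,h) and V(h,f) for one symmetric bilinear form V, twice the mixed area (`mixedForm`). When |E| =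
|K| this gives V(h,h) = V(f,f) and V(h,f) = (1 + δ) V(f,f), with δ the deficit.

The core is a quantitative Minkowski inequality (`exists_homothety_bound`). Fix a generic direction
a. A discrete Picone identity writes -V(g,g) as a sum over vertices of (height along a)² times a
weight that is negative only at the highest and the lowest vertex. Choosing t and y so that g = h -
t f - y·ν has height zero at these two leaves nonnegative terms, which control the increments of
g/(a × ν) around the cycle of normals. Hence g is close to a multiple of a × ν, and this is again a
translation. Translations lie in the kernel of V, so -V(g,g) = V(f,f)(2tδ - (1 - t)²). Its
nonnegativity forces |1 - t| = O(√δ) when δ ≤ 1, and `h` is within O(√δ) of a translate of `f`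
(`exists_translation_bound`).

Let ε be this distance. The oscillation integrand vanishes at points of the edge ν whose radial
projection from y lands on the edge ν of `K`. The other points have total length O(ε), and the
integrand is O(ε) there (`length_bad_le`, `oscillation_integral_le`), so the integral is O(ε²) =
O(δ). When δ is bounded below, the crude bound f(ν) + f(-ν) on the integrand suffices.

The link with De Giorgi's definitions is the divergence theorem: Dχ_E is -∑ ν ℋ¹ restricted to the
edges, and the reduced boundary is the union of the open edges (`hasOuterNormalAt_iff`). -/

/-- Counterclockwise rotation by a right angle. -/
def rot (v : Plane) : Plane := !₂[-v 1, v 0]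

/-- The determinant of two plane vectors. -/
def cross (u v : Plane) : ℝ := u 0 * v 1 - u 1 * v 0

lemma inner_eq (u v : Plane) : inner ℝ u v = u 0 * v 0 + u 1 * v 1 := by
  simp [PiLp.inner_apply, Fin.sum_univ_two, mul_comm]

@[simp] lemma rot_zero_apply (v : Plane) : rot v 0 = -v 1 := rfl

@[simp] lemma rot_one_apply (v : Plane) : rot v 1 = v 0 := rfl

lemma norm_sq_eq (v : Plane) : ‖v‖ ^ 2 = v 0 ^ 2 + v 1 ^ 2 := by
  rw [← real_inner_self_eq_norm_sq, inner_eq]; ring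

lemma unit_sq {v : Plane} (h : ‖v‖ = 1) : v 0 ^ 2 + v 1 ^ 2 = 1 := by
  rw [← norm_sq_eq, h]; norm_num

lemma norm_rot (v : Plane) : ‖rot v‖ = ‖v‖ := by
  have h : ‖rot v‖ ^ 2 = ‖v‖ ^ 2 := by simp [norm_sq_eq]; ring
  exact (sq_eq_sq₀ (norm_nonneg _) (norm_nonneg _)).1 h

lemma inner_rot_left (u v : Plane) : inner ℝ (rot u) v = cross u v := by
  rw [inner_eq, cross]; simp; ring

lemma cross_self (u : Plane) : cross u u = 0 := by simp [cross, mul_comm]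

lemma cross_swap (u v : Plane) : cross u v = -cross v u := by simp [cross]; ring

lemma cross_neg_right (u v : Plane) : cross u (-v) = -cross u v := by simp [cross]; ring

lemma plane_ext {u v : Plane} (h0 : u 0 = v 0) (h1 : u 1 = v 1) : u = v := by
  ext i; fin_cases i <;> assumption

lemma inner_sq_add_cross_sq {u v : Plane} (hu : ‖u‖ = 1) (hv : ‖v‖ = 1) :
    inner ℝ u v ^ 2 + cross u v ^ 2 = 1 := by
  rw [inner_eq, cross]
  linear_combination (v 0 ^ 2 + v 1 ^ 2) * unit_sq hu + unit_sq hv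

/-- Unit vectors with vanishing determinant agree up to sign. -/
lemma eq_or_eq_neg_of_cross_eq_zero {u v : Plane} (hu : ‖u‖ = 1) (hv : ‖v‖ = 1)
    (h : cross u v = 0) : v = u ∨ v = -u := by
  have h1 := inner_sq_add_cross_sq hu hv
  rw [h] at h1
  have hu2 := unit_sq hu
  have h2 : (inner ℝ u v - 1) * (inner ℝ u v + 1) = 0 := by linarith
  rw [cross] at h
  rw [inner_eq] at h2
  have e0 : v 0 = (u 0 * v 0 + u 1 * v 1) * u 0 := by linear_combination (-v 0) * hu2 - u 1 * h
  have e1 : v 1 = (u 0 * v 0 + u 1 * v 1) * u 1 := by linear_combination (-v 1) * hu2 + u 0 * h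
  rcases mul_eq_zero.1 h2 with h3 | h3
  · left
    have : u 0 * v 0 + u 1 * v 1 = 1 := by linarith
    rw [this] at e0 e1
    exact plane_ext (by linarith) (by linarith)
  · right
    have : u 0 * v 0 + u 1 * v 1 = -1 := by linarith
    rw [this] at e0 e1
    exact plane_ext (by simp; linarith) (by simp; linarith)

/-! ### Cyclically ordered sets of directions -/

/-- `σ` sends each direction of `N` to its counterclockwise successor in `N`, which is less than
half a turn away. -/
structure IsCyclicNext (N : Finset Plane) (σ : Plane → Plane) : Prop where
  unit : ∀ ν ∈ N, ‖ν‖ = 1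
  mem : ∀ ν ∈ N, σ ν ∈ N
  cross_pos : ∀ ν ∈ N, 0 < cross ν (σ ν)
  not_between : ∀ ν ∈ N, ∀ μ ∈ N, 0 < cross ν μ → 0 < cross μ (σ ν) → False

/-- Over angles in (0, π) the cotangent `inner / cross` is decreasing, so maximizing it over the
directions ahead of `ν` selects the nearest one. -/
lemma exists_isCyclicNext {N : Finset Plane} (unit : ∀ ν ∈ N, ‖ν‖ = 1)
    (h : ∀ ν ∈ N, ∃ μ ∈ N, 0 < cross ν μ) : ∃ σ, IsCyclicNext N σ := by
  classical
  have key : ∀ ν, ∃ ν', ν ∈ N → ν' ∈ N ∧ 0 < cross ν ν' ∧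
      ∀ μ ∈ N, 0 < cross ν μ → 0 < cross μ ν' → False := by
    intro ν
    by_cases hν : ν ∈ N
    swap
    · exact ⟨ν, fun h => absurd h hν⟩
    obtain ⟨μ₀, hμ₀, hpos⟩ := h ν hν
    obtain ⟨ν', hν', hmax⟩ := Finset.exists_max_image (N.filter fun μ => 0 < cross ν μ)
      (fun μ => inner ℝ ν μ / cross ν μ) ⟨μ₀, by simp [hμ₀, hpos]⟩
    rw [Finset.mem_filter] at hν'
    refine ⟨ν', fun _ => ⟨hν'.1, hν'.2, fun μ hμ h1 h2 => ?_⟩⟩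
    have h3 := hmax μ (by simp [hμ, h1])
    rw [div_le_div_iff₀ h1 hν'.2] at h3
    have h4 : inner ℝ ν μ * cross ν ν' - inner ℝ ν ν' * cross ν μ = cross μ ν' := by
      simp only [inner_eq, cross]
      linear_combination (μ 0 * ν' 1 - μ 1 * ν' 0) * unit_sq (unit ν hν)
    linarith
  choose σ hσ using key
  exact ⟨σ, unit, fun ν h => (hσ ν h).1, fun ν h => (hσ ν h).2.1, fun ν h => (hσ ν h).2.2⟩

namespace IsCyclicNext

variable {N : Finset Plane} {σ : Plane → Plane} (hσ : IsCyclicNext N σ)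
include hσ

/-- If two directions shared a successor, the one further ahead would lie between the other and that
successor. -/
lemma injOn : Set.InjOn σ N := by
  intro ν hν μ hμ h
  have h1 := hσ.cross_pos ν hν
  have h2 := hσ.cross_pos μ hμ
  rcases lt_trichotomy (cross ν μ) 0 with h3 | h3 | h3
  · rw [cross_swap] at h3
    exact (hσ.not_between μ hμ ν hν (by linarith) (h ▸ h1)).elim
  · rcases eq_or_eq_neg_of_cross_eq_zero (hσ.unit ν hν) (hσ.unit μ hμ) h3 with h4 | h4
    · exact h4.symm
    · rw [h4, cross_swap, cross_neg_right, cross_swap, ← h4, ← h] at h2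
      linarith
  · exact (hσ.not_between ν hν μ hμ h3 (h ▸ h2)).elim

lemma surjOn : ∀ ν ∈ N, ∃ μ ∈ N, σ μ = ν := fun _ hν =>
  Finset.surjOn_of_injOn_of_card_le σ (fun x hx => hσ.mem x hx) hσ.injOn le_rfl hν

/-- `σ` permutes `N`; this is what makes sums of differences `F ν - F (σ ν)` around the cycle
vanish. -/
lemma sum_comp (F : Plane → ℝ) : ∑ ν ∈ N, F (σ ν) = ∑ ν ∈ N, F ν :=
  Finset.sum_nbij σ hσ.mem hσ.injOn (fun _ hν => hσ.surjOn _ hν) fun _ _ => rfl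

/-- A nonempty subset closed under the successor map is everything. -/
lemma mem_of_closed {S : Set Plane} (hSN : S ⊆ N) (hne : S.Nonempty)
    (hS : ∀ ν ∈ S, σ ν ∈ S) : ∀ μ ∈ N, μ ∈ S := by
  classical
  intro μ hμ
  by_contra hμS
  have hunit := hσ.unit
  -- the last element of `S` before `μ`
  have h1 : ∀ ν ∈ S, ¬ 0 < cross ν μ := by
    by_contra! hex
    obtain ⟨ν₀, hν₀, hpos⟩ := hex
    obtain ⟨ν, hν, hmax⟩ := Finset.exists_max_image (N.filter fun ν => ν ∈ S ∧ 0 < cross ν μ)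
      (fun ν => inner ℝ ν μ / cross ν μ) ⟨ν₀, Finset.mem_filter.2 ⟨hSN hν₀, hν₀, hpos⟩⟩
    simp only [Finset.mem_filter] at hν hmax
    obtain ⟨hνN, hνS, hνμ⟩ := hν
    have h2 := hσ.not_between ν hνN μ hμ hνμ
    have h3 := hσ.cross_pos ν hνN
    have h4 : 0 ≤ cross (σ ν) μ := by
      rw [cross_swap]; by_contra h; exact h2 (by linarith)
    rcases h4.eq_or_lt with h5 | h5
    · rcases eq_or_eq_neg_of_cross_eq_zero (hunit _ (hσ.mem _ hνN)) (hunit _ hμ) h5.symm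
        with h6 | h6
      · exact hμS (h6 ▸ hS ν hνS)
      · rw [h6, cross_neg_right] at hνμ; linarith
    · have h6 := hmax (σ ν) ⟨hσ.mem _ hνN, hS ν hνS, h5⟩
      rw [div_le_div_iff₀ h5 hνμ] at h6
      have h7 : inner ℝ (σ ν) μ * cross ν μ - inner ℝ ν μ * cross (σ ν) μ = cross ν (σ ν) := by
        simp only [inner_eq, cross]
        linear_combination (ν 0 * σ ν 1 - ν 1 * σ ν 0) * unit_sq (hunit μ hμ)
      linarith
  -- The antipode `-μ` is excluded too, because its successor would lie before `μ`.
  have h2 : ∀ ν ∈ S, 0 < cross μ ν := by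
    intro ν hν
    have h3 := h1 ν hν
    rw [cross_swap] at h3
    rcases (show 0 ≤ cross μ ν by linarith).eq_or_lt with h4 | h4
    · rcases eq_or_eq_neg_of_cross_eq_zero (hunit _ hμ) (hunit _ (hSN hν)) h4.symm with h5 | h5
      · exact (hμS (h5 ▸ hν)).elim
      · have h6 := hσ.cross_pos ν (hSN hν)
        have h7 := h1 _ (hS ν hν)
        have h8 : cross (σ ν) μ = cross ν (σ ν) := by rw [h5]; simp [cross]; ring
        exact (h7 (h8 ▸ h6)).elim
    · exact h4
  obtain ⟨ν₀, hν₀⟩ := hne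
  -- All of `S` lies in the open half turn ahead of `μ`. The element of smallest cotangent is the
  -- furthest one, yet its successor is in `S` and further still.
  obtain ⟨ν, hν, hmin⟩ := Finset.exists_min_image (N.filter fun ν => ν ∈ S)
    (fun ν => inner ℝ μ ν / cross μ ν) ⟨ν₀, Finset.mem_filter.2 ⟨hSN hν₀, hν₀⟩⟩
  simp only [Finset.mem_filter] at hν hmin
  have h3 := hmin (σ ν) ⟨hσ.mem _ hν.1, hS _ hν.2⟩
  rw [div_le_div_iff₀ (h2 _ hν.2) (h2 _ (hS _ hν.2))] at h3
  have h4 := hσ.cross_pos ν hν.1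
  have h5 : inner ℝ μ ν * cross μ (σ ν) - inner ℝ μ (σ ν) * cross μ ν = cross ν (σ ν) := by
    simp only [inner_eq, cross]
    linear_combination (ν 0 * σ ν 1 - ν 1 * σ ν 0) * unit_sq (hunit μ hμ)
  linarith

/-- Small steps along the cycle give small total oscillation. -/
lemma exists_steps {ν₀ : Plane} (hν₀ : ν₀ ∈ N) : ∃ J : ℝ, 0 ≤ J ∧ ∀ (c : Plane → ℝ) (D : ℝ),
    (∀ ν ∈ N, |c ν - c (σ ν)| ≤ D) → ∀ ν ∈ N, |c ν - c ν₀| ≤ J * D := by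
  classical
  -- The directions admitting a bound `J` uniform in `c` and `D` form a set containing `ν₀` and
  -- closed under `σ`, with `J` growing by one at each step.
  have key : ∀ μ ∈ N, μ ∈ {ν ∈ (N : Set Plane) | ∃ J : ℝ, 0 ≤ J ∧ ∀ (c : Plane → ℝ) (D : ℝ),
      (∀ ν ∈ N, |c ν - c (σ ν)| ≤ D) → |c ν - c ν₀| ≤ J * D} := by
    refine hσ.mem_of_closed (fun ν h => h.1) ⟨ν₀, hν₀, 0, le_rfl, by simp⟩ ?_
    rintro ν ⟨hν, J, hJ, h⟩
    refine ⟨hσ.mem ν hν, J + 1, by linarith, fun c D hc => ?_⟩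
    have h1 := h c D hc
    have h2 := hc ν hν
    rw [abs_le] at *
    constructor <;> linarith
  choose! J hJ0 hJ using fun μ hμ => (key μ hμ).2
  refine ⟨∑ μ ∈ N, J μ, Finset.sum_nonneg hJ0, fun c D hc ν hν => (hJ ν hν c D hc).trans ?_⟩
  have hD : 0 ≤ D := (abs_nonneg _).trans (hc ν hν)
  gcongr
  exact Finset.single_le_sum hJ0 hν

end IsCyclicNext

/-- Some direction is not parallel to any element of a finite set of unit vectors. -/
lemma exists_generic_direction (N : Finset Plane) (unit : ∀ ν ∈ N, ‖ν‖ = 1) :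
    ∃ a : Plane, a ≠ 0 ∧ ∀ ν ∈ N, cross a ν ≠ 0 := by
  classical
  obtain ⟨t, ht⟩ := Infinite.exists_notMem_finset (N.image fun ν => ν 1 / ν 0)
  refine ⟨!₂[1, t], fun h => ?_, fun ν hν h => ?_⟩
  · have := congrArg (fun v : Plane => v 0) h
    simp at this
  · apply ht
    rw [Finset.mem_image]
    have hu := unit_sq (unit ν hν)
    simp [cross] at h
    have h0 : ν 0 ≠ 0 := by
      intro h0
      rw [h0] at h hu
      have : ν 1 = 0 := by linarith
      rw [this] at hu
      norm_num at hu
    exact ⟨ν, hν, by field_simp; linarith⟩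

/-! ### The mixed area as a bilinear form in the support numbers -/

/-- The contribution of two consecutive normals `ν`, `ν'` to twice the mixed area. -/
def pairForm (g w : Plane → ℝ) (ν ν' : Plane) : ℝ :=
  (g ν' * w ν + g ν * w ν' - (g ν * w ν + g ν' * w ν') * inner ℝ ν ν') / cross ν ν'

/-- Twice the mixed area, as a bilinear form in the support numbers. -/
def mixedForm (N : Finset Plane) (σ : Plane → Plane) (g w : Plane → ℝ) : ℝ :=
  ∑ ν ∈ N, pairForm g w ν (σ ν)

/-- The vertex cut out by the lines with normals `ν`, `ν'`, tested in direction `a`. -/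
def vertexCoord (a : Plane) (g : Plane → ℝ) (ν ν' : Plane) : ℝ :=
  (g ν * cross a ν' - g ν' * cross a ν) / cross ν ν'

/-- The addition formula for the sine, and in `cross_prev` the subtraction formula. They eliminate
the inner products with `a` in `pairForm_eq`. -/
lemma cross_next {ν : Plane} (a ν' : Plane) (hν : ‖ν‖ = 1) :
    cross a ν' = cross a ν * inner ℝ ν ν' + inner ℝ a ν * cross ν ν' := by
  simp only [cross, inner_eq]
  linear_combination (-(a 0 * ν' 1 - a 1 * ν' 0)) * unit_sq hν

lemma cross_prev {ν' : Plane} (a ν : Plane) (hν : ‖ν'‖ = 1) :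
    cross a ν = cross a ν' * inner ℝ ν ν' - inner ℝ a ν' * cross ν ν' := by
  simp only [cross, inner_eq]
  linear_combination (-(a 0 * ν 1 - a 1 * ν 0)) * unit_sq hν

/-- Picone type identity for one pair of consecutive normals. -/
lemma pairForm_eq {a ν ν' : Plane} (g : Plane → ℝ) (hν : ‖ν‖ = 1) (hν' : ‖ν'‖ = 1)
    (hx : cross ν ν' ≠ 0) (hs : cross a ν ≠ 0) (hs' : cross a ν' ≠ 0) :
    pairForm g g ν ν' = g ν ^ 2 * inner ℝ a ν / cross a ν - g ν' ^ 2 * inner ℝ a ν' / cross a ν'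
      - vertexCoord a g ν ν' ^ 2 * cross ν ν' / (cross a ν * cross a ν') := by
  have h1 : inner ℝ a ν = (cross a ν' - cross a ν * inner ℝ ν ν') / cross ν ν' := by
    rw [eq_div_iff hx, cross_next a ν' hν]; ring
  have h2 : inner ℝ a ν' = (cross a ν' * inner ℝ ν ν' - cross a ν) / cross ν ν' := by
    rw [eq_div_iff hx, cross_prev a ν hν']; ring
  rw [h1, h2, pairForm, vertexCoord]
  field_simp
  ring

section

variable {N : Finset Plane} {σ : Plane → Plane} (hσ : IsCyclicNext N σ)
include hσ

/-- The numbers `inner ℝ y ν` are the support numbers of the single point `y`, which sits at arc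
length `cross ν y` on the line of `ν` through it. The pair therefore contributes a difference that
telescopes around the cycle. -/
lemma pairForm_translation (g : Plane → ℝ) (y : Plane) {ν : Plane} (hν : ν ∈ N) :
    pairForm g (fun ν => inner ℝ y ν) ν (σ ν) =
      g ν * cross ν y - g (σ ν) * cross (σ ν) y := by
  have hx := (hσ.cross_pos ν hν).ne'
  have h1 := cross_next y (σ ν) (hσ.unit ν hν)
  have h2 := cross_prev y ν (hσ.unit _ (hσ.mem ν hν))
  have e1 : cross ν y * cross ν (σ ν) = inner ℝ y (σ ν) - inner ℝ y ν * inner ℝ ν (σ ν) := by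
    simp only [cross, inner_eq]
    linear_combination (y 0 * σ ν 0 + y 1 * σ ν 1) * unit_sq (hσ.unit ν hν)
  have e2 : cross (σ ν) y * cross ν (σ ν) = inner ℝ y (σ ν) * inner ℝ ν (σ ν) - inner ℝ y ν := by
    simp only [cross, inner_eq]
    linear_combination (-(y 0 * ν 0 + y 1 * ν 1)) * unit_sq (hσ.unit _ (hσ.mem ν hν))
  rw [pairForm, div_eq_iff hx]
  linear_combination (-g ν) * e1 + g (σ ν) * e2

lemma mixedForm_translation (g : Plane → ℝ) (y : Plane) :
    mixedForm N σ g (fun ν => inner ℝ y ν) = 0 := by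
  rw [mixedForm, Finset.sum_congr rfl fun ν hν => pairForm_translation hσ g y hν,
    Finset.sum_sub_distrib, hσ.sum_comp fun ν => g ν * cross ν y, sub_self]

lemma mixedForm_affine (h k : Plane → ℝ) (t : ℝ) (y : Plane) :
    mixedForm N σ (fun ν => h ν - t * k ν - inner ℝ y ν) (fun ν => h ν - t * k ν - inner ℝ y ν) =
      mixedForm N σ h h - 2 * t * mixedForm N σ h k + t ^ 2 * mixedForm N σ k k := by
  have e : mixedForm N σ (fun ν => h ν - t * k ν - inner ℝ y ν)
      (fun ν => h ν - t * k ν - inner ℝ y ν) =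
      mixedForm N σ h h - 2 * t * mixedForm N σ h k + t ^ 2 * mixedForm N σ k k
      - 2 * mixedForm N σ h (fun ν => inner ℝ y ν)
      + 2 * t * mixedForm N σ k (fun ν => inner ℝ y ν)
      + mixedForm N σ (fun ν => inner ℝ y ν) (fun ν => inner ℝ y ν) := by
    simp only [mixedForm, Finset.mul_sum, ← Finset.sum_sub_distrib, ← Finset.sum_add_distrib]
    refine Finset.sum_congr rfl fun ν _ => ?_
    simp only [pairForm]
    ring
  rw [e]
  simp [mixedForm_translation hσ]

/-- A generic line is crossed once in each direction by the cycle of normals. -/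
lemma exists_crossings {a : Plane} (ha : ∀ ν ∈ N, cross a ν ≠ 0) (ha0 : a ≠ 0)
    (hN : N.Nonempty) :
    (∃ ν ∈ N, 0 < cross a ν ∧ cross a (σ ν) < 0) ∧ ∃ ν ∈ N, cross a ν < 0 ∧ 0 < cross a (σ ν) := by
  have hpos : 0 < ‖a‖ ^ 2 := by have := norm_pos_iff.2 ha0; positivity
  have h1 : ∃ ν ∈ N, cross a ν * cross a (σ ν) < 0 := by
    by_contra! hcon
    -- Without a sign change every difference of consecutive cotangents would be positive, while
    -- their sum around the cycle is zero.
    have h2 : ∑ ν ∈ N, (inner ℝ a ν / cross a ν - inner ℝ a (σ ν) / cross a (σ ν)) = 0 := by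
      rw [Finset.sum_sub_distrib, hσ.sum_comp fun ν => inner ℝ a ν / cross a ν, sub_self]
    refine (Finset.sum_pos (fun ν hν => ?_) hN).ne' h2
    have hs := ha ν hν
    have hs' := ha _ (hσ.mem ν hν)
    have h3 : 0 < cross a ν * cross a (σ ν) :=
      lt_of_le_of_ne (hcon ν hν) (mul_ne_zero hs hs').symm
    have h4 : inner ℝ a ν / cross a ν - inner ℝ a (σ ν) / cross a (σ ν) =
        ‖a‖ ^ 2 * cross ν (σ ν) / (cross a ν * cross a (σ ν)) := by
      rw [norm_sq_eq]
      field_simp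
      simp only [inner_eq, cross]
      ring
    rw [h4]
    have := hσ.cross_pos ν hν
    positivity
  -- The indicator of the positive side returns to its initial value around the cycle, so a jump of
  -- either sign forces one of the other.
  let e : Plane → ℝ := fun ν => if 0 < cross a ν then 1 else 0
  have h2 : ∑ ν ∈ N, (e ν - e (σ ν)) = 0 := by
    rw [Finset.sum_sub_distrib, hσ.sum_comp e, sub_self]
  obtain ⟨ν, hν, hlt⟩ := h1
  have h3 : ∃ ν ∈ N, e ν - e (σ ν) ≠ 0 := by
    refine ⟨ν, hν, ?_⟩
    rcases mul_neg_iff.1 hlt with h | h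
    · simp [e, h.1, not_lt.2 h.2.le]
    · simp [e, not_lt.2 h.1.le, h.2]
  constructor
  · obtain ⟨μ, hμ, h⟩ := Finset.exists_pos_of_sum_zero_of_exists_nonzero _ h2 h3
    have h4 := ha _ (hσ.mem μ hμ)
    refine ⟨μ, hμ, ?_⟩
    simp only [e] at h
    split_ifs at h with h5 h6 h6
    · norm_num at h
    · exact ⟨h5, lt_of_le_of_ne (not_lt.1 h6) h4⟩
    · norm_num at h
    · norm_num at h
  · obtain ⟨μ, hμ, h⟩ := Finset.exists_pos_of_sum_zero_of_exists_nonzero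
      (fun ν => -(e ν - e (σ ν))) (by rw [Finset.sum_neg_distrib, h2, neg_zero])
      (by obtain ⟨μ, hμ, h⟩ := h3; exact ⟨μ, hμ, neg_ne_zero.2 h⟩)
    have h4 := ha μ hμ
    refine ⟨μ, hμ, ?_⟩
    simp only [e] at h
    split_ifs at h with h5 h6 h6
    · norm_num at h
    · norm_num at h
    · exact ⟨lt_of_le_of_ne (not_lt.1 h5) h4, h6⟩
    · norm_num at h

/-- By the three-term Plücker relation, `μ` would otherwise lie strictly between `ν` and `σ ν`. -/
lemma crossing_unique_aux {a ν μ : Plane} (hν : ν ∈ N) (hμ : μ ∈ N)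
    (h1 : 0 < cross a ν) (h2 : cross a (σ ν) < 0) (h3 : 0 < cross a μ) : ¬ 0 < cross ν μ := by
  intro h
  refine hσ.not_between ν hν μ hμ h ?_
  have hx := hσ.cross_pos ν hν
  have h4 : cross a ν * cross μ (σ ν) = cross a μ * cross ν (σ ν) - cross a (σ ν) * cross ν μ := by
    simp only [cross]; ring
  nlinarith [mul_pos h3 hx, mul_pos_of_neg_of_neg h2 (neg_lt_zero.2 h)]

lemma crossing_unique {a ν μ : Plane} (hν : ν ∈ N) (hμ : μ ∈ N)
    (h1 : 0 < cross a ν) (h2 : cross a (σ ν) < 0) (h3 : 0 < cross a μ) (h4 : cross a (σ μ) < 0) :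
    ν = μ := by
  have h5 := crossing_unique_aux hσ hν hμ h1 h2 h3
  have h6 := crossing_unique_aux hσ hμ hν h3 h4 h1
  rw [cross_swap] at h6
  rcases eq_or_eq_neg_of_cross_eq_zero (hσ.unit ν hν) (hσ.unit μ hμ) (by linarith) with h7 | h7
  · exact h7.symm
  · rw [h7, cross_neg_right] at h3; linarith

lemma crossing_unique' {a ν μ : Plane} (hν : ν ∈ N) (hμ : μ ∈ N)
    (h1 : cross a ν < 0) (h2 : 0 < cross a (σ ν)) (h3 : cross a μ < 0) (h4 : 0 < cross a (σ μ)) :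
    ν = μ := by
  have e : ∀ v, cross (-a) v = -cross a v := fun v => by simp [cross]; ring
  refine crossing_unique hσ hν hμ (a := -a) ?_ ?_ ?_ ?_ <;> rw [e] <;> linarith

/-- Translating and scaling `k` so that both crossing vertices of `h` and `k` have the same
height. -/
lemma exists_matching {a : Plane} (ha : ∀ ν ∈ N, cross a ν ≠ 0) (ha0 : a ≠ 0)
    (hN : N.Nonempty) {k : Plane → ℝ} (hk : ∀ ν ∈ N, 0 < k ν) (h : Plane → ℝ) :
    ∃ (t : ℝ) (y : Plane), ∀ ν ∈ N, cross a ν * cross a (σ ν) < 0 →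
      vertexCoord a (fun ν => h ν - t * k ν - inner ℝ y ν) ν (σ ν) = 0 := by
  obtain ⟨⟨ν₁, hν₁, h1, h1'⟩, ν₂, hν₂, h2, h2'⟩ := exists_crossings hσ ha ha0 hN
  have hpos : ‖a‖ ^ 2 ≠ 0 := by have := norm_pos_iff.2 ha0; positivity
  set Z := fun (g : Plane → ℝ) ν => vertexCoord a g ν (σ ν) with hZ
  -- The normal cones at the vertices `ν₁` and `ν₂` contain `-a` and `a`. Since `k` is positive,
  -- these two vertices lie strictly below and above the origin along `a`, and their height
  -- difference can be divided by.
  have hk1 : Z k ν₁ < 0 := by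
    refine div_neg_of_neg_of_pos ?_ (hσ.cross_pos _ hν₁)
    nlinarith [mul_pos (hk _ hν₁) (neg_pos.2 h1'), mul_pos (hk _ (hσ.mem _ hν₁)) h1]
  have hk2 : 0 < Z k ν₂ := by
    refine div_pos ?_ (hσ.cross_pos _ hν₂)
    nlinarith [mul_pos (hk _ hν₂) h2', mul_pos (hk _ (hσ.mem _ hν₂)) (neg_pos.2 h2)]
  have hne : Z k ν₁ - Z k ν₂ ≠ 0 := by linarith
  -- Scaling by `t` matches the height difference of the two vertices of `k` with that of `h`; the
  -- translation `b • a` then matches the heights themselves.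
  set t := (Z h ν₁ - Z h ν₂) / (Z k ν₁ - Z k ν₂)
  have ht : t * (Z k ν₁ - Z k ν₂) = Z h ν₁ - Z h ν₂ := div_mul_cancel₀ _ hne
  set b := (Z h ν₁ - t * Z k ν₁) / ‖a‖ ^ 2
  have hb : b * ‖a‖ ^ 2 = Z h ν₁ - t * Z k ν₁ := div_mul_cancel₀ _ hpos
  have lin : ∀ ν ∈ N, vertexCoord a (fun ν => h ν - t * k ν - inner ℝ (b • a) ν) ν (σ ν) =
      Z h ν - t * Z k ν - b * ‖a‖ ^ 2 := by
    intro ν hν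
    have hx := (hσ.cross_pos ν hν).ne'
    simp only [hZ, vertexCoord]
    rw [norm_sq_eq]
    field_simp
    simp only [inner_eq, cross, PiLp.smul_apply, smul_eq_mul]
    ring
  refine ⟨t, b • a, fun ν hν hlt => ?_⟩
  rw [lin ν hν]
  rcases mul_neg_iff.1 hlt with h | h
  · rw [crossing_unique hσ hν hν₁ h.1 h.2 h1 h1']; linarith
  · rw [crossing_unique' hσ hν hν₂ h.1 h.2 h2 h2']; linarith

/-- Negativity of the mixed area form on matched support numbers, with an explicit remainder. -/
lemma neg_mixedForm_eq {a : Plane} (ha : ∀ ν ∈ N, cross a ν ≠ 0) (g : Plane → ℝ) :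
    -mixedForm N σ g g =
      ∑ ν ∈ N, vertexCoord a g ν (σ ν) ^ 2 * cross ν (σ ν) / (cross a ν * cross a (σ ν)) := by
  rw [mixedForm, Finset.sum_congr rfl fun ν hν => pairForm_eq g (hσ.unit ν hν)
    (hσ.unit _ (hσ.mem ν hν)) (hσ.cross_pos ν hν).ne' (ha ν hν) (ha _ (hσ.mem ν hν)),
    Finset.sum_sub_distrib, Finset.sum_sub_distrib,
    hσ.sum_comp fun ν => g ν ^ 2 * inner ℝ a ν / cross a ν]
  ring

/-- **Stability of Minkowski's inequality** among polygons with fixed normals: the deviation of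
`h` from a homothetic copy of `k` is controlled by the mixed area form. -/
lemma exists_homothety_bound (hN : N.Nonempty) {k : Plane → ℝ} (hk : ∀ ν ∈ N, 0 < k ν) :
    ∃ C : ℝ, 0 ≤ C ∧ ∀ h : Plane → ℝ, ∃ (t : ℝ) (y : Plane),
      mixedForm N σ h h - 2 * t * mixedForm N σ h k + t ^ 2 * mixedForm N σ k k ≤ 0 ∧
      ∀ ν ∈ N, (h ν - t * k ν - inner ℝ y ν) ^ 2 ≤ C *
        -(mixedForm N σ h h - 2 * t * mixedForm N σ h k + t ^ 2 * mixedForm N σ k k) := by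
  obtain ⟨a, ha0, ha⟩ := exists_generic_direction N hσ.unit
  obtain ⟨ν₀, hν₀⟩ := id hN
  obtain ⟨J, hJ0, hJ⟩ := hσ.exists_steps hν₀
  set M := ∑ ν ∈ N, |cross ν (σ ν) / (cross a ν * cross a (σ ν))|
  have hM0 : 0 ≤ M := Finset.sum_nonneg fun _ _ => abs_nonneg _
  refine ⟨‖a‖ ^ 2 * J ^ 2 * M, by positivity, fun h => ?_⟩
  obtain ⟨t, y, hty⟩ := exists_matching hσ ha ha0 hN hk h
  set g := fun ν => h ν - t * k ν - inner ℝ y ν with hg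
  set S := -mixedForm N σ g g with hS
  -- The only negative weights sit at the two crossings, where matching kills the vertex coordinate.
  have hterm : ∀ ν ∈ N, 0 ≤
      vertexCoord a g ν (σ ν) ^ 2 * cross ν (σ ν) / (cross a ν * cross a (σ ν)) := by
    intro ν hν
    have hx := hσ.cross_pos ν hν
    by_cases hlt : cross a ν * cross a (σ ν) < 0
    · rw [hty ν hν hlt]; simp
    · have := not_lt.1 hlt
      positivity
  have hS' := neg_mixedForm_eq hσ ha g
  have hS0 : 0 ≤ S := by rw [hS, hS']; exact Finset.sum_nonneg hterm
  set c := fun ν => g ν / cross a ν with hc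
  -- The increment of `c` is the vertex coordinate times the weight, so its square is the weight, at
  -- most `M` in absolute value, times one term of the sum `S`.
  have hstep : ∀ ν ∈ N, |c ν - c (σ ν)| ≤ √(M * S) := by
    intro ν hν
    have hs := ha ν hν
    have hs' := ha _ (hσ.mem ν hν)
    have hx := hσ.cross_pos ν hν
    apply Real.abs_le_sqrt
    have e1 : c ν - c (σ ν) =
        vertexCoord a g ν (σ ν) * cross ν (σ ν) / (cross a ν * cross a (σ ν)) := by
      simp only [hc, vertexCoord]
      field_simp
    rw [e1]
    by_cases hlt : cross a ν * cross a (σ ν) < 0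
    · rw [hty ν hν hlt]; simp; positivity
    · have hnn := not_lt.1 hlt
      have e2 : (vertexCoord a g ν (σ ν) * cross ν (σ ν) / (cross a ν * cross a (σ ν))) ^ 2 =
          |cross ν (σ ν) / (cross a ν * cross a (σ ν))| *
          (vertexCoord a g ν (σ ν) ^ 2 * cross ν (σ ν) / (cross a ν * cross a (σ ν))) := by
        rw [abs_of_nonneg (by positivity)]; ring
      rw [e2]
      refine mul_le_mul (Finset.single_le_sum
        (f := fun ν => |cross ν (σ ν) / (cross a ν * cross a (σ ν))|)
        (fun _ _ => abs_nonneg _) hν) ?_ (hterm ν hν) hM0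
      rw [hS, hS']
      exact Finset.single_le_sum (f := fun ν => vertexCoord a g ν (σ ν) ^ 2 * cross ν (σ ν) /
        (cross a ν * cross a (σ ν))) hterm hν
  have hbound := hJ c _ hstep
  -- If `c` were constant, `g` would be that constant times `cross a ν = inner ℝ (rot a) ν`, the
  -- support numbers of a translation. The value `c ν₀` is absorbed into `y` accordingly.
  refine ⟨t, y + c ν₀ • rot a, ?_, fun ν hν => ?_⟩
  · rw [← mixedForm_affine hσ h k t y]; linarith
  have hs := ha ν hν
  have e3 : h ν - t * k ν - inner ℝ (y + c ν₀ • rot a) ν = cross a ν * (c ν - c ν₀) := by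
    rw [inner_add_left, real_inner_smul_left, inner_rot_left]
    have : g ν = c ν * cross a ν := (div_mul_cancel₀ _ hs).symm
    simp only [hg] at this
    linear_combination this
  rw [e3, ← mixedForm_affine hσ h k t y, mul_pow]
  have e4 : cross a ν ^ 2 ≤ ‖a‖ ^ 2 := by
    rw [norm_sq_eq, cross]
    have := unit_sq (hσ.unit ν hν)
    nlinarith [sq_nonneg (a 0 * ν 0 + a 1 * ν 1)]
  have e5 : (c ν - c ν₀) ^ 2 ≤ J ^ 2 * (M * S) := by
    rw [← sq_abs, ← Real.sq_sqrt (mul_nonneg hM0 hS0), ← mul_pow]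
    exact pow_le_pow_left₀ (abs_nonneg _) (hbound ν hν) 2
  calc cross a ν ^ 2 * (c ν - c ν₀) ^ 2 ≤ ‖a‖ ^ 2 * (J ^ 2 * (M * S)) := by gcongr
    _ = ‖a‖ ^ 2 * J ^ 2 * M * -mixedForm N σ g g := by rw [hS]; ring

/-- If the mixed area of `h` and `k` is almost minimal, then `h` is close to a translate of `k`. -/
theorem exists_translation_bound (hN : N.Nonempty) {k : Plane → ℝ} (hk : ∀ ν ∈ N, 0 < k ν)
    (hV : 0 < mixedForm N σ k k) :
    ∃ C : ℝ, 0 < C ∧ ∀ (h : Plane → ℝ) (δ : ℝ), mixedForm N σ h h = mixedForm N σ k k →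
      mixedForm N σ h k = (1 + δ) * mixedForm N σ k k → 0 < 1 + δ →
      0 ≤ δ ∧ (δ ≤ 1 → ∃ y : Plane, ∀ ν ∈ N, (h ν - k ν - inner ℝ y ν) ^ 2 ≤ C * δ) := by
  obtain ⟨C, hC0, hC⟩ := exists_homothety_bound hσ hN hk
  set V := mixedForm N σ k k
  set k₀ := ∑ ν ∈ N, k ν
  -- For δ ≤ 1 one gets t ≤ 4, so both squared errors carry 2tδ ≤ 8δ; splitting the square of their
  -- sum doubles this to 16.
  refine ⟨16 * k₀ ^ 2 + 16 * C * V + 1, by positivity, fun h δ hh hhk hδ => ?_⟩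
  obtain ⟨t, y, ht, hty⟩ := hC h
  rw [hh, hhk] at hty ht
  have ht2 : V * ((1 - t) ^ 2) ≤ V * (2 * t * δ) := by linarith
  have ht3 : (1 - t) ^ 2 ≤ 2 * t * δ := le_of_mul_le_mul_left ht2 hV
  have htpos : 0 < t := by
    by_contra hcon
    nlinarith [mul_nonneg (neg_nonneg.2 (not_lt.1 hcon)) hδ.le, sq_nonneg t]
  have hδ0 : 0 ≤ δ := by
    by_contra hcon
    nlinarith [mul_pos htpos (neg_pos.2 (not_le.1 hcon)), sq_nonneg (1 - t)]
  refine ⟨hδ0, fun hδ1 => ⟨y, fun ν hν => ?_⟩⟩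
  have ht4 : t ≤ 4 := by nlinarith [mul_le_mul_of_nonneg_left hδ1 htpos.le]
  have hkν : k ν ≤ k₀ := Finset.single_le_sum (fun μ hμ => (hk μ hμ).le) hν
  have h1 : (h ν - t * k ν - inner ℝ y ν) ^ 2 ≤ C * (V * (8 * δ)) := by
    refine (hty ν hν).trans (mul_le_mul_of_nonneg_left ?_ hC0)
    have : V * (2 * t * δ - (1 - t) ^ 2) ≤ V * (8 * δ) :=
      mul_le_mul_of_nonneg_left (by nlinarith [sq_nonneg (1 - t)]) hV.le
    linarith
  have h2 : ((1 - t) * k ν) ^ 2 ≤ 8 * δ * k₀ ^ 2 := by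
    rw [mul_pow]
    have := (hk ν hν).le
    gcongr
    nlinarith
  have h3 : (h ν - k ν - inner ℝ y ν) ^ 2 ≤
      2 * (h ν - t * k ν - inner ℝ y ν) ^ 2 + 2 * ((1 - t) * k ν) ^ 2 := by
    nlinarith [sq_nonneg ((h ν - t * k ν - inner ℝ y ν) + (1 - t) * k ν)]
  linarith

end

/-! ### Irredundant descriptions of convex polygons -/

/-- `E` is the bounded open polygon `{x : x · ν < h ν for ν ∈ N}`, where `N` consists of unit
vectors and no constraint is redundant. -/
structure IsReducedPolygon (N : Finset Plane) (h : Plane → ℝ) (E : Set Plane) : Prop where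
  unit : ∀ ν ∈ N, ‖ν‖ = 1
  nonempty : E.Nonempty
  bounded : Bornology.IsBounded E
  eq : E = {x | ∀ ν ∈ N, inner ℝ x ν < h ν}
  facet : ∀ ν ∈ N, ∃ p : Plane, inner ℝ p ν = h ν ∧ ∀ μ ∈ N, μ ≠ ν → inner ℝ p μ < h μ

/-- Discarding redundant constraints. -/
lemma exists_isReducedPolygon_subset {M : Finset Plane} {h : Plane → ℝ} {E : Set Plane}
    (unit : ∀ ν ∈ M, ‖ν‖ = 1) (hne : E.Nonempty) (hb : Bornology.IsBounded E)
    (hE : E = {x | ∀ ν ∈ M, inner ℝ x ν < h ν}) : ∃ N ⊆ M, IsReducedPolygon N h E := by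
  classical
  -- In a description with the fewest constraints, dropping any one enlarges the set.
  obtain ⟨N, hN, hmin⟩ := Finset.exists_min_image
    (M.powerset.filter fun N => E = {x | ∀ ν ∈ N, inner ℝ x ν < h ν}) Finset.card
    ⟨M, Finset.mem_filter.2 ⟨Finset.mem_powerset_self M, hE⟩⟩
  simp only [Finset.mem_filter, Finset.mem_powerset] at hN hmin
  refine ⟨N, hN.1, fun ν hν => unit ν (hN.1 hν), hne, hb, hN.2, fun ν hν => ?_⟩
  have h1 : E ≠ {x | ∀ μ ∈ N.erase ν, inner ℝ x μ < h μ} := fun h2 => by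
    have h3 := hmin (N.erase ν) ⟨(Finset.erase_subset _ _).trans hN.1, h2⟩
    have h4 := Finset.card_erase_lt_of_mem hν
    omega
  have h2 : ∃ x : Plane, (∀ μ ∈ N, μ ≠ ν → inner ℝ x μ < h μ) ∧ h ν ≤ inner ℝ x ν := by
    by_contra! hcon
    apply h1
    ext x
    rw [hN.2]
    simp only [Set.mem_ofPred_eq, Finset.mem_erase]
    refine ⟨fun hx μ hμ => hx μ hμ.2, fun hx μ hμ => ?_⟩
    by_cases hμν : μ = ν
    · rw [hμν]; exact hcon x fun μ h1 h2 => hx μ ⟨h2, h1⟩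
    · exact hx μ ⟨hμν, hμ⟩
  obtain ⟨x, hx, hxν⟩ := h2
  obtain ⟨x₀, hx₀⟩ := hne
  rw [hN.2] at hx₀
  have h3 := hx₀ ν hν
  -- `x` violates the constraint `ν` alone; the segment from the interior point `x₀` to `x` crosses
  -- the line of `ν` at a point of its open side.
  set t := (h ν - inner ℝ x₀ ν) / (inner ℝ x ν - inner ℝ x₀ ν) with ht
  have hd : 0 < inner ℝ x ν - inner ℝ x₀ ν := by linarith
  have ht0 : 0 < t := div_pos (by linarith) hd
  have ht1 : t ≤ 1 := (div_le_one hd).2 (by linarith)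
  have htm : t * (inner ℝ x ν - inner ℝ x₀ ν) = h ν - inner ℝ x₀ ν := div_mul_cancel₀ _ hd.ne'
  refine ⟨(1 - t) • x₀ + t • x, ?_, fun μ hμ hμν => ?_⟩
  · rw [inner_add_left, real_inner_smul_left, real_inner_smul_left]; linarith
  · rw [inner_add_left, real_inner_smul_left, real_inner_smul_left]
    have h4 := hx μ hμ hμν
    have h5 := hx₀ μ hμ
    nlinarith [mul_nonneg (sub_nonneg.2 ht1) (sub_nonneg.2 h5.le), mul_pos ht0 (sub_pos.2 h4)]

/-- After rescaling to unit normals several half-planes may share a direction. Only the tightest is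
kept, so that the support number becomes a function of the normal. -/
lemma IsOpenConvexPolygon.exists_isReducedPolygon {E : Set Plane} (hE : IsOpenConvexPolygon E) :
    ∃ N h, IsReducedPolygon N h E := by
  classical
  obtain ⟨hne, hb, s, hs, hEs⟩ := hE
  let n : Plane × ℝ → Plane := fun p => ‖p.1‖⁻¹ • p.1
  have key : ∀ ν, ∃ c : ℝ, ν ∈ s.image n →
      ((∃ p ∈ s, n p = ν ∧ c = ‖p.1‖⁻¹ * p.2) ∧ ∀ p ∈ s, n p = ν → c ≤ ‖p.1‖⁻¹ * p.2) := by
    intro ν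
    by_cases hν : ν ∈ s.image n
    swap
    · exact ⟨0, fun h => absurd h hν⟩
    obtain ⟨p₀, hp₀, hn⟩ := Finset.mem_image.1 hν
    obtain ⟨p, hp, hmin⟩ := Finset.exists_min_image (s.filter fun p => n p = ν)
      (fun p => ‖p.1‖⁻¹ * p.2) ⟨p₀, Finset.mem_filter.2 ⟨hp₀, hn⟩⟩
    rw [Finset.mem_filter] at hp
    exact ⟨_, fun _ => ⟨⟨p, hp.1, hp.2, rfl⟩, fun q hq hqn =>
      hmin q (Finset.mem_filter.2 ⟨hq, hqn⟩)⟩⟩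
  choose h hh using key
  have hpos : ∀ p ∈ s, 0 < ‖p.1‖⁻¹ := fun p hp => inv_pos.2 (norm_pos_iff.2 (hs p hp))
  have hin : ∀ (p : Plane × ℝ) (x : Plane), inner ℝ x (n p) = ‖p.1‖⁻¹ * inner ℝ x p.1 :=
    fun p x => real_inner_smul_right _ _ _
  obtain ⟨N, -, hN⟩ := exists_isReducedPolygon_subset (M := s.image n) (h := h) (E := E)
    (by
      intro ν hν
      obtain ⟨p, hp, rfl⟩ := Finset.mem_image.1 hν
      rw [norm_smul, norm_inv, norm_norm, inv_mul_cancel₀ (norm_ne_zero_iff.2 (hs p hp))])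
    hne hb (by
      rw [hEs]
      ext x
      simp only [Set.mem_ofPred_eq]
      constructor
      · intro hx ν hν
        obtain ⟨⟨p, hp, hpν, hc⟩, -⟩ := hh ν hν
        rw [hc, ← hpν, hin]
        exact mul_lt_mul_of_pos_left (hx p hp) (hpos p hp)
      · intro hx p hp
        have h1 := hx (n p) (Finset.mem_image_of_mem n hp)
        have h2 := (hh (n p) (Finset.mem_image_of_mem n hp)).2 p hp rfl
        rw [hin] at h1
        exact lt_of_mul_lt_mul_left (h1.trans_le h2) (hpos p hp).le)
  exact ⟨N, h, hN⟩

/-- The closed edge with normal `ν`. -/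
def edge (N : Finset Plane) (h : Plane → ℝ) (ν : Plane) : Set Plane :=
  {x | inner ℝ x ν = h ν ∧ ∀ μ ∈ N, inner ℝ x μ ≤ h μ}

/-- The relatively open edge with normal `ν`. -/
def side (N : Finset Plane) (h : Plane → ℝ) (ν : Plane) : Set Plane :=
  {x | inner ℝ x ν = h ν ∧ ∀ μ ∈ N, μ ≠ ν → inner ℝ x μ < h μ}

/-- Arc length parametrization of the line `{x : x · ν = h ν}`. -/
def linePt (h : Plane → ℝ) (ν : Plane) (s : ℝ) : Plane := h ν • ν + s • rot ν

lemma inner_linePt (h : Plane → ℝ) (ν μ : Plane) (s : ℝ) :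
    inner ℝ (linePt h ν s) μ = h ν * inner ℝ ν μ + s * cross ν μ := by
  rw [linePt, inner_add_left, real_inner_smul_left, real_inner_smul_left, inner_rot_left]

lemma inner_linePt_self (h : Plane → ℝ) {ν : Plane} (hν : ‖ν‖ = 1) (s : ℝ) :
    inner ℝ (linePt h ν s) ν = h ν := by
  rw [inner_linePt, real_inner_self_eq_norm_sq, hν, cross_self]; ring

lemma eq_linePt {h : Plane → ℝ} {ν x : Plane} (hν : ‖ν‖ = 1) (hx : inner ℝ x ν = h ν) :
    x = linePt h ν (cross ν x) := by
  have hu := unit_sq hν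
  rw [inner_eq] at hx
  apply plane_ext
  · simp only [linePt, PiLp.add_apply, PiLp.smul_apply, smul_eq_mul, rot_zero_apply, cross, ← hx]
    linear_combination (-x 0) * hu
  · simp only [linePt, PiLp.add_apply, PiLp.smul_apply, smul_eq_mul, rot_one_apply, cross, ← hx]
    linear_combination (-x 1) * hu

lemma dist_linePt (h : Plane → ℝ) {ν : Plane} (hν : ‖ν‖ = 1) (s t : ℝ) :
    dist (linePt h ν s) (linePt h ν t) = |s - t| := by
  rw [dist_eq_norm, linePt, linePt, add_sub_add_left_eq_sub, ← sub_smul, norm_smul, norm_rot, hν,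
    mul_one, Real.norm_eq_abs]

lemma isometry_linePt (h : Plane → ℝ) {ν : Plane} (hν : ‖ν‖ = 1) : Isometry (linePt h ν) :=
  Isometry.of_dist_eq fun s t => by rw [dist_linePt h hν, Real.dist_eq]

lemma side_subset_edge {N : Finset Plane} {h : Plane → ℝ} {ν : Plane} :
    side N h ν ⊆ edge N h ν := by
  rintro x ⟨h1, h2⟩
  refine ⟨h1, fun μ hμ => ?_⟩
  by_cases hμν : μ = ν
  · rw [hμν, h1]
  · exact (h2 μ hμ hμν).le

namespace IsReducedPolygon

variable {N : Finset Plane} {h : Plane → ℝ} {E : Set Plane} (hE : IsReducedPolygon N h E)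
include hE

lemma mem_iff (x : Plane) : x ∈ E ↔ ∀ ν ∈ N, inner ℝ x ν < h ν := by
  nth_rewrite 1 [hE.eq]
  rfl

/-- By boundedness, no ray is contained in `E`. -/
lemma exists_inner_pos {v : Plane} (hv : v ≠ 0) : ∃ μ ∈ N, 0 < inner ℝ v μ := by
  by_contra! hcon
  obtain ⟨x₀, hx₀⟩ := hE.nonempty
  obtain ⟨R, hR⟩ := hE.bounded.exists_norm_le
  have hpos := norm_pos_iff.2 hv
  have hR0 : 0 ≤ R := (norm_nonneg _).trans (hR x₀ hx₀)
  set t := (2 * R + 1) / ‖v‖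
  have ht : 0 ≤ t := by positivity
  have h1 : x₀ + t • v ∈ E := by
    rw [hE.mem_iff] at hx₀ ⊢
    intro μ hμ
    rw [inner_add_left, real_inner_smul_left]
    have := mul_nonneg ht (neg_nonneg.2 (hcon μ hμ))
    linarith [hx₀ μ hμ]
  have h2 : ‖t • v‖ ≤ ‖x₀ + t • v‖ + ‖x₀‖ := by
    have := norm_sub_le (x₀ + t • v) x₀
    rwa [add_sub_cancel_left] at this
  have h3 : ‖t • v‖ = 2 * R + 1 := by
    rw [norm_smul, Real.norm_of_nonneg ht, div_mul_cancel₀ _ hpos.ne']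
  linarith [hR _ h1, hR _ hx₀]

lemma exists_cross_pos {ν : Plane} (hν : ν ∈ N) : ∃ μ ∈ N, 0 < cross ν μ := by
  obtain ⟨μ, hμ, h⟩ := hE.exists_inner_pos (v := rot ν) (by
    rw [← norm_ne_zero_iff, norm_rot, hE.unit ν hν]; exact one_ne_zero)
  exact ⟨μ, hμ, by rwa [inner_rot_left] at h⟩

lemma normals_nonempty : N.Nonempty := by
  obtain ⟨μ, hμ, -⟩ := hE.exists_inner_pos (v := !₂[1, 0]) (fun h => by
    have := congrArg (fun v : Plane => v 0) h
    simp at this)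
  exact ⟨μ, hμ⟩

lemma opposite {ν : Plane} (hν : ν ∈ N) (hν' : -ν ∈ N) : 0 < h ν + h (-ν) := by
  obtain ⟨x, hx⟩ := hE.nonempty
  rw [hE.mem_iff] at hx
  have h1 := hx ν hν
  have h2 := hx _ hν'
  rw [inner_neg_right] at h2
  linarith

/-- On the line of `ν`, each `μ` with `cross ν μ > 0` bounds the arc length from above, and the
bound of the successor is the tightest. Indeed `σ ν` is a nonnegative combination of `ν` and `μ`,
and a point `q` of its own side satisfies the constraints `ν` and `μ`. -/
lemma next_le {σ : Plane → Plane} (hσ : IsCyclicNext N σ) {ν μ : Plane} (hν : ν ∈ N) (hμ : μ ∈ N)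
    (hx : 0 < cross ν μ) : (h (σ ν) - h ν * inner ℝ ν (σ ν)) / cross ν (σ ν) ≤
      (h μ - h ν * inner ℝ ν μ) / cross ν μ := by
  have hx' := hσ.cross_pos ν hν
  have h1 : 0 ≤ cross (σ ν) μ := by
    by_contra hcon
    rw [cross_swap] at hcon
    exact hσ.not_between ν hν μ hμ hx (by linarith)
  obtain ⟨q, hq⟩ : (side N h (σ ν)).Nonempty := hE.facet _ (hσ.mem ν hν)
  obtain ⟨hq, hq'⟩ := side_subset_edge hq
  rw [div_le_div_iff₀ hx' hx]
  have e1 : cross ν μ * inner ℝ q (σ ν) =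
      cross (σ ν) μ * inner ℝ q ν + cross ν (σ ν) * inner ℝ q μ := by
    simp only [cross, inner_eq]; ring
  have e2 : cross ν μ * inner ℝ ν (σ ν) = cross (σ ν) μ + cross ν (σ ν) * inner ℝ ν μ := by
    simp only [cross, inner_eq]
    linear_combination (σ ν 0 * μ 1 - σ ν 1 * μ 0) * unit_sq (hE.unit ν hν)
  rw [hq] at e1
  have h2 := mul_le_mul_of_nonneg_left (hq' ν hν) h1
  have h3 := mul_le_mul_of_nonneg_left (hq' μ hμ) hx'.le
  linear_combination e1 + h2 + h3 - h ν * e2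

/-- Mirror image of `next_le`, for the lower end of the line of `σ π`. -/
lemma prev_le {σ : Plane → Plane} (hσ : IsCyclicNext N σ) {π μ : Plane} (hπ : π ∈ N) (hμ : μ ∈ N)
    (hx : 0 < cross μ (σ π)) : (h π - h (σ π) * inner ℝ π (σ π)) / cross π (σ π) ≤
      (h μ - h (σ π) * inner ℝ (σ π) μ) / cross μ (σ π) := by
  have hx' := hσ.cross_pos π hπ
  have h1 : 0 ≤ cross μ π := by
    by_contra hcon
    rw [cross_swap] at hcon
    exact hσ.not_between π hπ μ hμ (by linarith) hx
  obtain ⟨q, hq⟩ : (side N h π).Nonempty := hE.facet _ hπ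
  obtain ⟨hq, hq'⟩ := side_subset_edge hq
  rw [div_le_div_iff₀ hx' hx]
  have e1 : cross μ (σ π) * inner ℝ q π =
      cross π (σ π) * inner ℝ q μ + cross μ π * inner ℝ q (σ π) := by
    simp only [cross, inner_eq]; ring
  have e2 : cross μ (σ π) * inner ℝ π (σ π) =
      cross π (σ π) * inner ℝ (σ π) μ + cross μ π := by
    simp only [cross, inner_eq]
    linear_combination (μ 0 * π 1 - μ 1 * π 0) * unit_sq (hE.unit _ (hσ.mem π hπ))
  rw [hq] at e1
  have h2 := mul_le_mul_of_nonneg_left (hq' _ (hσ.mem π hπ)) h1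
  have h3 := mul_le_mul_of_nonneg_left (hq' μ hμ) hx'.le
  linear_combination e1 + h2 + h3 - h (σ π) * e2

/-- Every edge is a nondegenerate segment, whose end points depend linearly on the support
numbers of the adjacent edges. -/
lemma exists_edge_param {σ : Plane → Plane} (hσ : IsCyclicNext N σ) :
    ∃ lo hi : Plane → ℝ, (∀ ν ∈ N, lo ν < hi ν ∧ edge N h ν = linePt h ν '' Icc (lo ν) (hi ν) ∧
      side N h ν = linePt h ν '' Ioo (lo ν) (hi ν)) ∧
      ∀ w : Plane → ℝ, ∑ ν ∈ N, w ν * (hi ν - lo ν) = mixedForm N σ h w := by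
  choose! π hπ hσπ using hσ.surjOn
  set hi : Plane → ℝ := fun ν => (h (σ ν) - h ν * inner ℝ ν (σ ν)) / cross ν (σ ν) with hhi
  set lo : Plane → ℝ := fun ν => -((h (π ν) - h ν * inner ℝ (π ν) ν) / cross (π ν) ν) with hlo
  have unit := hE.unit
  have up : ∀ ν ∈ N, ∀ μ ∈ N, 0 < cross ν μ →
      hi ν ≤ (h μ - h ν * inner ℝ ν μ) / cross ν μ := fun ν hν μ hμ hx =>
    hE.next_le hσ hν hμ hx
  have down : ∀ ν ∈ N, ∀ μ ∈ N, cross ν μ < 0 → (h μ - h ν * inner ℝ ν μ) / cross ν μ ≤ lo ν := by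
    intro ν hν μ hμ hx
    have h1 := hE.prev_le hσ (hπ ν hν) hμ (by rw [hσπ ν hν, cross_swap]; linarith)
    rw [hσπ ν hν] at h1
    simp only [hlo]
    rw [le_neg, ← div_neg, ← cross_swap]
    exact h1
  have hi_iff : ∀ ν ∈ N, ∀ s : ℝ, h ν * inner ℝ ν (σ ν) + s * cross ν (σ ν) < h (σ ν) ↔ s < hi ν := by
    intro ν hν s
    rw [hhi, lt_div_iff₀ (hσ.cross_pos ν hν), lt_sub_iff_add_lt']
  have hi_iff' : ∀ ν ∈ N, ∀ s : ℝ, h ν * inner ℝ ν (σ ν) + s * cross ν (σ ν) ≤ h (σ ν) ↔ s ≤ hi ν := by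
    intro ν hν s
    rw [hhi, le_div_iff₀ (hσ.cross_pos ν hν), le_sub_iff_add_le']
  have pos : ∀ ν ∈ N, 0 < cross (π ν) ν := fun ν hν => by
    have := hσ.cross_pos _ (hπ ν hν)
    rwa [hσπ ν hν] at this
  have lo_iff : ∀ ν ∈ N, ∀ s : ℝ, h ν * inner ℝ ν (π ν) + s * cross ν (π ν) < h (π ν) ↔ lo ν < s := by
    intro ν hν s
    rw [hlo, neg_lt, lt_div_iff₀ (pos ν hν), cross_swap, real_inner_comm]
    constructor <;> intro h <;> linarith
  have lo_iff' : ∀ ν ∈ N, ∀ s : ℝ, h ν * inner ℝ ν (π ν) + s * cross ν (π ν) ≤ h (π ν) ↔ lo ν ≤ s := by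
    intro ν hν s
    rw [hlo, neg_le, le_div_iff₀ (pos ν hν), cross_swap, real_inner_comm]
    constructor <;> intro h <;> linarith
  have next_ne : ∀ ν ∈ N, σ ν ≠ ν := fun ν hν h => by
    have := hσ.cross_pos ν hν
    rw [h, cross_self] at this
    exact lt_irrefl _ this
  have prev_ne : ∀ ν ∈ N, π ν ≠ ν := fun ν hν h => by
    have := pos ν hν
    rw [h, cross_self] at this
    exact lt_irrefl _ this
  have edge_eq : ∀ ν ∈ N, edge N h ν = linePt h ν '' Icc (lo ν) (hi ν) := by
    intro ν hν
    ext x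
    constructor
    · rintro ⟨h1, h2⟩
      rw [eq_linePt (unit ν hν) h1] at h2 ⊢
      refine ⟨_, ⟨(lo_iff' ν hν _).1 ?_, (hi_iff' ν hν _).1 ?_⟩, rfl⟩
      · rw [← inner_linePt]; exact h2 _ (hπ ν hν)
      · rw [← inner_linePt]; exact h2 _ (hσ.mem ν hν)
    · rintro ⟨s, ⟨h1, h2⟩, rfl⟩
      refine ⟨inner_linePt_self h (unit ν hν) s, fun μ hμ => ?_⟩
      rw [inner_linePt]
      rcases lt_trichotomy (cross ν μ) 0 with hx | hx | hx
      · have := (div_le_iff_of_neg hx).1 ((down ν hν μ hμ hx).trans h1)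
        linarith
      · rw [hx]
        rcases eq_or_eq_neg_of_cross_eq_zero (unit ν hν) (unit μ hμ) hx with rfl | rfl
        · rw [real_inner_self_eq_norm_sq, unit _ hμ]; linarith
        · rw [inner_neg_right, real_inner_self_eq_norm_sq, unit _ hν]
          linarith [hE.opposite hν hμ]
      · have := (le_div_iff₀ hx).1 (h2.trans (up ν hν μ hμ hx))
        linarith
  have side_eq : ∀ ν ∈ N, side N h ν = linePt h ν '' Ioo (lo ν) (hi ν) := by
    intro ν hν
    ext x
    constructor
    · rintro ⟨h1, h2⟩
      rw [eq_linePt (unit ν hν) h1] at h2 ⊢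
      refine ⟨_, ⟨(lo_iff ν hν _).1 ?_, (hi_iff ν hν _).1 ?_⟩, rfl⟩
      · rw [← inner_linePt]; exact h2 _ (hπ ν hν) (prev_ne ν hν)
      · rw [← inner_linePt]; exact h2 _ (hσ.mem ν hν) (next_ne ν hν)
    · rintro ⟨s, ⟨h1, h2⟩, rfl⟩
      refine ⟨inner_linePt_self h (unit ν hν) s, fun μ hμ hμν => ?_⟩
      rw [inner_linePt]
      rcases lt_trichotomy (cross ν μ) 0 with hx | hx | hx
      · have := (div_lt_iff_of_neg hx).1 ((down ν hν μ hμ hx).trans_lt h1)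
        linarith
      · rw [hx]
        rcases eq_or_eq_neg_of_cross_eq_zero (unit ν hν) (unit μ hμ) hx with rfl | rfl
        · exact (hμν rfl).elim
        · rw [inner_neg_right, real_inner_self_eq_norm_sq, unit _ hν]
          linarith [hE.opposite hν hμ]
      · have := (lt_div_iff₀ hx).1 (h2.trans_le (up ν hν μ hμ hx))
        linarith
  refine ⟨lo, hi, fun ν hν => ⟨?_, edge_eq ν hν, side_eq ν hν⟩, fun w => ?_⟩
  · obtain ⟨p, hp⟩ : (side N h ν).Nonempty := hE.facet ν hν
    rw [side_eq ν hν] at hp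
    obtain ⟨s, hs, -⟩ := hp
    exact hs.1.trans hs.2
  · simp only [mul_sub, Finset.sum_sub_distrib]
    -- Regrouping by vertices: the upper end on `ν` and the lower end on `σ ν` are the same vertex,
    -- and together give one `pairForm`.
    rw [← hσ.sum_comp fun ν => w ν * lo ν, mixedForm, ← Finset.sum_sub_distrib]
    refine Finset.sum_congr rfl fun ν hν => ?_
    have e : π (σ ν) = ν := hσ.injOn (hπ _ (hσ.mem ν hν)) hν (hσπ _ (hσ.mem ν hν))
    simp only [hhi, hlo, e, pairForm]
    ring

end IsReducedPolygon

/-! ### The divergence theorem on a convex polygon -/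

/-- The fundamental theorem of calculus on an interval described by finitely many affine
constraints in general position. -/
lemma integral_deriv_constraints {ι : Type*} {N : Finset ι} {α β : ι → ℝ} {ψ ψ' : ℝ → ℝ}
    (hψ : ∀ s, HasDerivAt ψ (ψ' s) s) (hψ' : Continuous ψ')
    (hpos : ∃ i ∈ N, 0 < α i) (hneg : ∃ i ∈ N, α i < 0)
    (hzero : ∀ i ∈ N, α i = 0 → β i ≠ 0)
    (hgen : ∀ i ∈ N, ∀ j ∈ N, i ≠ j → α i ≠ 0 → α j ≠ 0 → β i / α i ≠ β j / α j) :
    ∫ s in {s | ∀ i ∈ N, α i * s < β i}, ψ' s =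
      ∑ i ∈ N, Real.sign (α i) *
        open Classical in if ∀ j ∈ N, α j * (β i / α i) ≤ β j then ψ (β i / α i) else 0 := by
  classical
  by_cases hS : ∃ s₀, ∀ i ∈ N, α i * s₀ < β i
  · obtain ⟨s₀, hs₀⟩ := hS
    obtain ⟨u, hu, hmin⟩ := Finset.exists_min_image (N.filter fun i => 0 < α i)
      (fun i => β i / α i) (by obtain ⟨i, hi, h⟩ := hpos; exact ⟨i, Finset.mem_filter.2 ⟨hi, h⟩⟩)
    obtain ⟨l, hl, hmax⟩ := Finset.exists_max_image (N.filter fun i => α i < 0)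
      (fun i => β i / α i) (by obtain ⟨i, hi, h⟩ := hneg; exact ⟨i, Finset.mem_filter.2 ⟨hi, h⟩⟩)
    simp only [Finset.mem_filter, and_imp] at hu hl hmin hmax
    obtain ⟨huN, hu⟩ := hu
    obtain ⟨hlN, hl⟩ := hl
    have hsu : s₀ < β u / α u := by rw [lt_div_iff₀ hu, mul_comm]; exact hs₀ u huN
    have hls : β l / α l < s₀ := by rw [div_lt_iff_of_neg hl, mul_comm]; exact hs₀ l hlN
    have hlu := hls.trans hsu
    have hset : {s | ∀ i ∈ N, α i * s < β i} = Ioo (β l / α l) (β u / α u) := by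
      ext s
      constructor
      · intro hs
        exact ⟨by rw [div_lt_iff_of_neg hl, mul_comm]; exact hs l hlN,
          by rw [lt_div_iff₀ hu, mul_comm]; exact hs u huN⟩
      · rintro ⟨h1, h2⟩ i hi
        rcases lt_trichotomy (α i) 0 with h | h | h
        · have := (hmax i hi h).trans_lt h1
          rwa [div_lt_iff_of_neg h, mul_comm] at this
        · have := hs₀ i hi
          rw [h, zero_mul] at this ⊢
          exact this
        · have := h2.trans_le (hmin i hi h)
          rwa [lt_div_iff₀ h, mul_comm] at this
    have hclos : ∀ s, β l / α l ≤ s → s ≤ β u / α u → ∀ j ∈ N, α j * s ≤ β j := by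
      intro s h1 h2 i hi
      rcases lt_trichotomy (α i) 0 with h | h | h
      · have := (hmax i hi h).trans h1
        rwa [div_le_iff_of_neg h, mul_comm] at this
      · have := hs₀ i hi
        rw [h, zero_mul] at this ⊢
        exact this.le
      · have := h2.trans (hmin i hi h)
        rwa [le_div_iff₀ h, mul_comm] at this
    have hne : u ≠ l := fun h => by rw [h] at hu; linarith
    rw [hset, ← integral_Ioc_eq_integral_Ioo, ← intervalIntegral.integral_of_le hlu.le,
      intervalIntegral.integral_eq_sub_of_hasDerivAt (fun s _ => hψ s)
        (hψ'.intervalIntegrable _ _)]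
    -- By general position, the only feasible boundary points with a nonzero sign are those of the
    -- tightest upper and the tightest lower constraint.
    rw [Finset.sum_eq_add u l hne _ (fun h => absurd huN h) (fun h => absurd hlN h)]
    · rw [if_pos (hclos _ hlu.le le_rfl), if_pos (hclos _ le_rfl hlu.le), Real.sign_of_pos hu,
        Real.sign_of_neg hl]
      ring
    · rintro i hi ⟨hiu, hil⟩
      rcases lt_trichotomy (α i) 0 with h | h | h
      · rw [if_neg, mul_zero]
        intro hc
        have h1 := hc l hlN
        rw [mul_comm, ← div_le_iff_of_neg hl] at h1
        exact hgen i hi l hlN hil h.ne hl.ne (le_antisymm (hmax i hi h) h1)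
      · rw [h, Real.sign_zero, zero_mul]
      · rw [if_neg, mul_zero]
        intro hc
        have h1 := hc u huN
        rw [mul_comm, ← le_div_iff₀ hu] at h1
        exact hgen i hi u huN hiu h.ne' hu.ne' (le_antisymm h1 (hmin i hi h))
  · have hset : {s | ∀ i ∈ N, α i * s < β i} = ∅ := by
      ext s
      exact ⟨fun hs => hS ⟨s, hs⟩, fun hs => hs.elim⟩
    rw [hset, setIntegral_empty]
    symm
    refine Finset.sum_eq_zero fun i hi => ?_
    by_cases h0 : α i = 0
    · rw [h0, Real.sign_zero, zero_mul]
    rw [if_neg, mul_zero]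
    intro hc
    apply hS
    -- At a feasible boundary point of `i` all other constraints are strict by general position, so
    -- a small move against `α i` would make the empty slice nonempty.
    have hev : ∀ᶠ ε : ℝ in 𝓝[>] 0, ∀ j ∈ N, α j * (β i / α i - ε * α i) < β j := by
      rw [Filter.eventually_all_finset]
      intro j hj
      by_cases hij : i = j
      · subst hij
        filter_upwards [self_mem_nhdsWithin] with ε hε
        rw [mul_sub, mul_div_cancel₀ _ h0]
        have : 0 < α i ^ 2 := by positivity
        nlinarith [mul_pos (mem_Ioi.1 hε) this]
      · have hlt : α j * (β i / α i) < β j := by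
          refine lt_of_le_of_ne (hc j hj) fun heq => ?_
          by_cases hj0 : α j = 0
          · rw [hj0, zero_mul] at heq
            exact hzero j hj hj0 heq.symm
          · refine hgen i hi j hj hij h0 hj0 ?_
            rw [eq_div_iff hj0, mul_comm]; exact heq
        have hcont : Tendsto (fun ε : ℝ => α j * (β i / α i - ε * α i)) (𝓝[>] 0)
            (𝓝 (α j * (β i / α i - 0 * α i))) :=
          (Continuous.tendsto (by fun_prop) 0).mono_left nhdsWithin_le_nhds
        rw [zero_mul, sub_zero] at hcont
        exact hcont.eventually_lt_const hlt
    obtain ⟨ε, hε⟩ := hev.exists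
    exact ⟨_, hε⟩

/-- Cartesian coordinates along `e` and `rot e` preserve the Lebesgue measure. -/
lemma measurePreserving_coords {e : Plane} (he : ‖e‖ = 1) :
    MeasurePreserving (fun p : ℝ × ℝ => p.1 • e + p.2 • rot e) volume volume := by
  let L : Plane →ₗᵢ[ℝ] Plane :=
    { toFun := fun x => x 0 • e + x 1 • rot e
      map_add' := fun x y => by simp only [PiLp.add_apply, add_smul]; abel
      map_smul' := fun c x => by simp [mul_smul]
      norm_map' := fun x => by
        have h : ‖x 0 • e + x 1 • rot e‖ ^ 2 = ‖x‖ ^ 2 := by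
          simp only [norm_sq_eq, PiLp.add_apply, PiLp.smul_apply, smul_eq_mul, rot_zero_apply,
            rot_one_apply]
          linear_combination (x 0 ^ 2 + x 1 ^ 2) * unit_sq he
        exact (sq_eq_sq₀ (norm_nonneg _) (norm_nonneg _)).1 h }
  have h1 := (L.toLinearIsometryEquiv rfl).measurePreserving
  have h2 := PiLp.volume_preserving_toLp (Fin 2)
  have h3 := (volume_preserving_finTwoArrow ℝ).symm
  exact h1.comp (h2.comp h3)

/-- One-dimensional Hausdorff measure on a line in its arc length parametrization. -/
lemma hausdorff_restrict_linePt (h : Plane → ℝ) {ν : Plane} (hν : ‖ν‖ = 1) {S : Set ℝ} :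
    (μH[1] : Measure Plane).restrict (linePt h ν '' S) =
      (volume.restrict S).map (linePt h ν) := by
  have hiso := isometry_linePt h hν
  have hemb : MeasurableEmbedding (linePt h ν) := hiso.isClosedEmbedding.measurableEmbedding
  have h1 := hiso.map_hausdorffMeasure (d := 1) (Or.inl zero_le_one)
  rw [hausdorffMeasure_real] at h1
  have h2 := hemb.restrict_map volume (linePt h ν '' S)
  rw [h1, Set.preimage_image_eq _ hiso.injective,
    Measure.restrict_restrict_of_subset (image_subset_range _ _)] at h2
  exact h2

lemma integral_linePt (h : Plane → ℝ) {ν : Plane} (hν : ‖ν‖ = 1) (S : Set ℝ)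
    (φ : Plane → ℝ) : ∫ x in linePt h ν '' S, φ x ∂μH[1] = ∫ s in S, φ (linePt h ν s) := by
  rw [hausdorff_restrict_linePt h hν,
    (isometry_linePt h hν).isClosedEmbedding.measurableEmbedding.integral_map]

lemma hausdorff_image_linePt (h : Plane → ℝ) {ν : Plane} (hν : ‖ν‖ = 1) (S : Set ℝ) :
    (μH[1] : Measure Plane) (linePt h ν '' S) = volume S := by
  rw [(isometry_linePt h hν).hausdorffMeasure_image (Or.inl zero_le_one), hausdorffMeasure_real]

namespace IsReducedPolygon

variable {N : Finset Plane} {h : Plane → ℝ} {E : Set Plane} (hE : IsReducedPolygon N h E)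
include hE

lemma isOpen : IsOpen E := by
  rw [hE.eq]
  have : {x : Plane | ∀ ν ∈ N, inner ℝ x ν < h ν} = ⋂ ν ∈ N, {x | inner ℝ x ν < h ν} := by
    ext x; simp
  rw [this]
  exact isOpen_biInter_finset fun ν _ => isOpen_lt (by fun_prop) continuous_const

lemma integrableOn {F : Plane → ℝ} (hF : Continuous F) : IntegrableOn F E := by
  obtain ⟨R, hR⟩ := hE.bounded.exists_norm_le
  refine (hF.locallyIntegrable.integrableOn_isCompact (isCompact_closedBall (0 : Plane) R)).mono_set
    fun x hx => ?_
  rw [mem_closedBall_zero_iff]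
  exact hR x hx

/-- Almost every line parallel to `e` meets the sides of the polygon in general position. -/
lemma ae_generic {e : Plane} (he : ‖e‖ = 1) : ∀ᵐ r : ℝ,
    (∀ ν ∈ N, inner ℝ e ν = 0 → h ν - r * inner ℝ (rot e) ν ≠ 0) ∧
    ∀ ν ∈ N, ∀ μ ∈ N, ν ≠ μ → inner ℝ e ν ≠ 0 → inner ℝ e μ ≠ 0 →
      (h ν - r * inner ℝ (rot e) ν) / inner ℝ e ν ≠
        (h μ - r * inner ℝ (rot e) μ) / inner ℝ e μ := by
  have haff : ∀ a b : ℝ, (b ≠ 0 ∨ a ≠ 0) → ∀ᵐ r : ℝ, a - r * b ≠ 0 := by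
    intro a b hab
    rw [ae_iff]
    refine Set.Subsingleton.measure_zero (fun r hr s hs => ?_) _
    have hr : a - r * b = 0 := not_not.1 hr
    have hs : a - s * b = 0 := not_not.1 hs
    rcases hab with hb | ha
    · exact mul_right_cancel₀ hb (by linarith)
    · have hb : b ≠ 0 := fun hb => ha (by rw [hb] at hr; linarith)
      exact mul_right_cancel₀ hb (by linarith)
  refine Filter.Eventually.and ?_ ?_
  · rw [Filter.eventually_all_finset]
    intro ν hν
    by_cases h0 : inner ℝ e ν = 0
    swap
    · exact .of_forall fun r hr => absurd hr h0
    have h1 := inner_sq_add_cross_sq he (hE.unit ν hν)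
    rw [← inner_rot_left, h0] at h1
    have h2 : inner ℝ (rot e) ν ≠ 0 := fun h2 => by rw [h2] at h1; norm_num at h1
    filter_upwards [haff (h ν) _ (.inl h2)] with r hr _ using hr
  · rw [Filter.eventually_all_finset]
    intro ν hν
    rw [Filter.eventually_all_finset]
    intro μ hμ
    by_cases hne : ν ≠ μ ∧ inner ℝ e ν ≠ 0 ∧ inner ℝ e μ ≠ 0
    swap
    · exact .of_forall fun r h1 h2 h3 => absurd ⟨h1, h2, h3⟩ hne
    obtain ⟨hne, h1, h2⟩ := hne
    -- A coincidence is an affine equation in `r`. It could hold identically only for opposite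
    -- normals with `h ν + h (-ν) = 0`, which is impossible for a nonempty open polygon.
    have h3 : inner ℝ (rot e) ν * inner ℝ e μ - inner ℝ (rot e) μ * inner ℝ e ν ≠ 0 ∨
        h ν * inner ℝ e μ - h μ * inner ℝ e ν ≠ 0 := by
      by_contra! hcon
      have h4 : cross ν μ = 0 := by
        have h5 : inner ℝ (rot e) ν * inner ℝ e μ - inner ℝ (rot e) μ * inner ℝ e ν =
            -cross ν μ := by
          simp only [inner_eq, cross, rot_zero_apply, rot_one_apply]
          linear_combination (-(ν 0 * μ 1 - ν 1 * μ 0)) * unit_sq he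
        linarith [hcon.1]
      rcases eq_or_eq_neg_of_cross_eq_zero (hE.unit ν hν) (hE.unit μ hμ) h4 with h5 | h5
      · exact hne h5.symm
      · subst h5
        have h6 := hcon.2
        rw [inner_neg_right] at h6
        have h7 : (h ν + h (-ν)) * inner ℝ e ν = 0 := by linarith
        rcases mul_eq_zero.1 h7 with h8 | h8
        · exact (hE.opposite hν hμ).ne' h8
        · exact h1 h8
    filter_upwards [haff _ _ h3] with r hr _ _ _ heq
    apply hr
    rw [div_eq_div_iff h1 h2] at heq
    linarith

/-- The divergence theorem on a polygon, in the direction `e`. -/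
theorem integral_fderiv {φ : Plane → ℝ} (hφ : ContDiff ℝ 1 φ) {e : Plane} (he : ‖e‖ = 1) :
    ∫ x in E, fderiv ℝ φ x e = ∑ ν ∈ N, inner ℝ e ν * ∫ x in edge N h ν, φ x ∂μH[1] := by
  classical
  obtain ⟨σ, hσ⟩ := exists_isCyclicNext hE.unit fun ν hν => hE.exists_cross_pos hν
  obtain ⟨lo, hi, hpar, -⟩ := hE.exists_edge_param hσ
  have hF : Continuous fun x => fderiv ℝ φ x e :=
    (hφ.continuous_fderiv one_ne_zero).clm_apply continuous_const
  set F := fun x => fderiv ℝ φ x e with hFdef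
  have hmp := measurePreserving_coords he
  set Φ := fun p : ℝ × ℝ => p.1 • e + p.2 • rot e with hΦ
  have hEm := hE.isOpen.measurableSet
  have hFi : Integrable (E.indicator F) := (integrable_indicator_iff hEm).2 (hE.integrableOn hF)
  have hmeas : AEStronglyMeasurable (E.indicator F) (volume.map Φ) := by
    rw [hmp.map_eq]; exact hFi.aestronglyMeasurable
  have hcomp : Integrable (fun p : ℝ × ℝ => E.indicator F (Φ p)) := by
    have := hmp.integrable_comp hFi.aestronglyMeasurable
    exact this.2 hFi
  have e1 : ∫ x in E, F x = ∫ r : ℝ, ∫ s : ℝ, E.indicator F (Φ (s, r)) := by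
    rw [← integral_indicator hEm, ← hmp.map_eq, integral_map hmp.measurable.aemeasurable hmeas]
    exact integral_prod_symm _ hcomp
  set G := fun ν => (Icc (lo ν) (hi ν)).indicator fun s => φ (linePt h ν s) with hG
  have hGi : ∀ ν ∈ N, Integrable (G ν) := by
    intro ν hν
    refine (integrable_indicator_iff measurableSet_Icc).2 ?_
    exact (hφ.continuous.comp (isometry_linePt h (hE.unit ν hν)).continuous).continuousOn
      |>.integrableOn_Icc
  -- `G ν` is the edge integrand extended by zero, so the feasibility condition at an end point of
  -- the slice is carried by its indicator, evaluated at the arc length where the slice meets the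
  -- line of `ν`.
  have hslice : ∀ᵐ r : ℝ, ∫ s : ℝ, E.indicator F (Φ (s, r)) = ∑ ν ∈ N,
      Real.sign (inner ℝ e ν) * G ν ((r - h ν * inner ℝ (rot e) ν) / inner ℝ e ν) := by
    filter_upwards [hE.ae_generic he] with r hr
    have hΦin : ∀ s ν, inner ℝ (Φ (s, r)) ν = inner ℝ e ν * s + r * inner ℝ (rot e) ν := by
      intro s ν
      simp only [hΦ]
      rw [inner_add_left, real_inner_smul_left, real_inner_smul_left]
      ring
    have hset : {s | ∀ ν ∈ N, inner ℝ e ν * s < h ν - r * inner ℝ (rot e) ν} =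
        (fun s => Φ (s, r)) ⁻¹' E := by
      ext s
      rw [Set.mem_preimage, hE.mem_iff]
      simp only [Set.mem_ofPred_eq, hΦin, lt_sub_iff_add_lt]
    have hcont : Continuous fun s : ℝ => Φ (s, r) := by simp only [hΦ]; fun_prop
    have e2 : ∫ s : ℝ, E.indicator F (Φ (s, r)) =
        ∫ s in {s | ∀ ν ∈ N, inner ℝ e ν * s < h ν - r * inner ℝ (rot e) ν}, F (Φ (s, r)) := by
      rw [hset, ← integral_indicator (hcont.measurable hEm)]
      rfl
    have hder : ∀ s, HasDerivAt (fun s => φ (Φ (s, r))) (F (Φ (s, r))) s := by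
      intro s
      have h1 := ((hφ.differentiable one_ne_zero) (Φ (s, r))).hasFDerivAt
      have h2 : HasDerivAt (fun s : ℝ => Φ (s, r)) e s := by
        have h3 := ((hasDerivAt_id s).smul_const e).add_const (r • rot e)
        rwa [one_smul] at h3
      exact h1.comp_hasDerivAt s h2
    rw [e2, integral_deriv_constraints hder (hF.comp hcont) (hE.exists_inner_pos
      (norm_ne_zero_iff.1 (by rw [he]; exact one_ne_zero))) (by
        obtain ⟨μ, hμ, h⟩ := hE.exists_inner_pos (v := -e)
          (norm_ne_zero_iff.1 (by rw [norm_neg, he]; exact one_ne_zero))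
        exact ⟨μ, hμ, by rw [inner_neg_left] at h; linarith⟩) hr.1 hr.2]
    refine Finset.sum_congr rfl fun ν hν => ?_
    by_cases h0 : inner ℝ e ν = 0
    · rw [h0, Real.sign_zero, zero_mul, zero_mul]
    congr 1
    set s' := (r - h ν * inner ℝ (rot e) ν) / inner ℝ e ν with hs'
    have hpt : Φ ((h ν - r * inner ℝ (rot e) ν) / inner ℝ e ν, r) = linePt h ν s' := by
      have hin : inner ℝ (Φ ((h ν - r * inner ℝ (rot e) ν) / inner ℝ e ν, r)) ν = h ν := by
        rw [hΦin, mul_div_cancel₀ _ h0]; ring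
      rw [eq_linePt (hE.unit ν hν) hin]
      congr 1
      rw [hs', eq_div_iff h0]
      have h3 : inner ℝ (rot e) (Φ ((h ν - r * inner ℝ (rot e) ν) / inner ℝ e ν, r)) = r := by
        simp only [hΦ]
        rw [inner_add_right, real_inner_smul_right, real_inner_smul_right,
          real_inner_self_eq_norm_sq, norm_rot, he,
          show inner ℝ (rot e) e = 0 by rw [inner_rot_left, cross_self]]
        ring
      set X := Φ ((h ν - r * inner ℝ (rot e) ν) / inner ℝ e ν, r)
      have h4 : cross ν X * inner ℝ e ν = inner ℝ (rot e) X - inner ℝ X ν * inner ℝ (rot e) ν := by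
        simp only [cross, inner_eq, rot_zero_apply, rot_one_apply]
        linear_combination (e 0 * X 1 - e 1 * X 0) * unit_sq (hE.unit ν hν)
      rw [h4, h3, hin]
    have hiff : (∀ μ ∈ N, inner ℝ e μ * ((h ν - r * inner ℝ (rot e) ν) / inner ℝ e ν) ≤
        h μ - r * inner ℝ (rot e) μ) ↔ s' ∈ Icc (lo ν) (hi ν) := by
      have h5 : s' ∈ Icc (lo ν) (hi ν) ↔ linePt h ν s' ∈ edge N h ν := by
        rw [(hpar ν hν).2.1, (isometry_linePt h (hE.unit ν hν)).injective.mem_set_image]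
      rw [h5, ← hpt]
      simp only [le_sub_iff_add_le, ← hΦin]
      refine ⟨fun h6 => ⟨?_, h6⟩, fun h6 => h6.2⟩
      rw [hpt]
      exact inner_linePt_self h (hE.unit ν hν) _
    simp only [hG, Set.indicator_apply, hiff, hpt]
  have hsubst : ∀ ν ∈ N, Integrable (fun r : ℝ =>
      Real.sign (inner ℝ e ν) * G ν ((r - h ν * inner ℝ (rot e) ν) / inner ℝ e ν)) := by
    intro ν hν
    by_cases h0 : inner ℝ e ν = 0
    · simp [h0]
    · exact (((hGi ν hν).comp_div h0).comp_sub_right _).const_mul _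
  rw [e1, integral_congr_ae hslice, integral_finsetSum _ hsubst]
  refine Finset.sum_congr rfl fun ν hν => ?_
  rw [integral_const_mul, (hpar ν hν).2.1, integral_linePt h (hE.unit ν hν),
    integral_sub_right_eq_self (fun r => G ν (r / inner ℝ e ν)), Measure.integral_comp_div,
    smul_eq_mul, hG, integral_indicator measurableSet_Icc, ← mul_assoc]
  congr 1
  -- Passing from `r` to arc length has Jacobian `|inner ℝ e ν|`, and the sign of the end point
  -- restores the factor `inner ℝ e ν`.
  rcases lt_trichotomy (inner ℝ e ν) 0 with h0 | h0 | h0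
  · rw [Real.sign_of_neg h0, abs_of_neg h0]; ring
  · simp [h0]
  · rw [Real.sign_of_pos h0, abs_of_pos h0]; ring

end IsReducedPolygon

/-! ### Vector measures of finite variation -/

section VectorMeasure

variable {X : Type*} [MeasurableSpace X]

/-- The vector measure `A ↦ m A • v`. -/
def smulMeasure (m : Measure X) [IsFiniteMeasure m] (v : Plane) : VectorMeasure X Plane :=
  m.toSignedMeasure.mapRange
    (ContinuousLinearMap.toSpanSingleton ℝ v : ℝ →L[ℝ] Plane).toAddMonoidHom
    (ContinuousLinearMap.toSpanSingleton ℝ v).continuous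

lemma smulMeasure_apply (m : Measure X) [IsFiniteMeasure m] (v : Plane) {A : Set X}
    (hA : MeasurableSet A) : smulMeasure m v A = m.real A • v := by
  refine (VectorMeasure.mapRange_apply (v := m.toSignedMeasure) _).trans ?_
  rw [Measure.toSignedMeasure_apply_measurable hA]
  rfl

lemma variation_smulMeasure_le (m : Measure X) [IsFiniteMeasure m] (v : Plane) :
    (smulMeasure m v).variation ≤ ‖v‖₊ • m := by
  refine VectorMeasure.variation_le_of_forall_enorm_le fun A hA => ?_
  rw [smulMeasure_apply m v hA, enorm_smul, Measure.smul_apply, mul_comm,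
    Real.enorm_of_nonneg measureReal_nonneg, ofReal_measureReal]
  rfl

lemma integral_smulMeasure (m : Measure X) [IsFiniteMeasure m] (v : Plane) {φ : X → ℝ}
    (hφ : Integrable φ m) :
    (smulMeasure m v).integral φ (ContinuousLinearMap.lsmul ℝ ℝ) = (∫ x, φ x ∂m) • v := by
  set C : ℝ →L[ℝ] Plane := ContinuousLinearMap.toSpanSingleton ℝ v
  have hφ' : Integrable φ m.toSignedMeasure.variation := by
    rwa [Measure.variation_toSignedMeasure]
  have h1 := VectorMeasure.integral_continuousLinearMap_comp (μ := m.toSignedMeasure)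
    (B := (ContinuousLinearMap.lsmul ℝ ℝ (E := Plane)).flip) (C := C) hφ'
  rw [VectorMeasure.integral_toSignedMeasure, ContinuousLinearMap.integral_comp_comm C hφ] at h1
  have h2 : C (∫ x, φ x ∂m) = (∫ x, φ x ∂m) • v := ContinuousLinearMap.toSpanSingleton_apply ..
  rw [← h2, h1, VectorMeasure.integral_eq_setToFun, VectorMeasure.integral_eq_setToFun]
  -- Both integrals extend the same operator-valued set function; only the dominating measures
  -- differ, and one is at most `‖v‖` times the other.
  have hT : ((smulMeasure m v).transpose (ContinuousLinearMap.lsmul ℝ ℝ) : Set X → ℝ →L[ℝ] Plane) =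
      m.toSignedMeasure.transpose ((ContinuousLinearMap.lsmul ℝ ℝ (E := Plane)).flip ∘L C) := by
    funext A
    by_cases hA : MeasurableSet A
    · ext1
      rw [transpose_eq_cbmApplyMeasure, transpose_eq_cbmApplyMeasure,
        cbmApplyMeasure_apply, cbmApplyMeasure_apply, smulMeasure_apply m v hA,
        Measure.toSignedMeasure_apply_measurable hA]
      simp [C]
    · rw [VectorMeasure.not_measurable _ hA, VectorMeasure.not_measurable _ hA]
  have hdom := dominatedFinMeasAdditive_cbmApplyMeasure (smulMeasure m v)
    (ContinuousLinearMap.lsmul ℝ ℝ (E := Plane))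
  rw [setToFun_congr_left _ (hT ▸ hdom) hT]
  refine (setToFun_congr_measure_of_integrable (‖v‖₊ : ℝ≥0∞) ENNReal.coe_ne_top ?_ _ _ _ hφ').symm
  rw [Measure.variation_toSignedMeasure]
  exact variation_smulMeasure_le m v

/-- A vector measure of finite variation on the plane is determined by its action on test
functions. -/
lemma eq_zero_of_integral_eq_zero {μ : VectorMeasure Plane Plane} (hμ : μ.variation univ < ∞)
    (h : ∀ φ : Plane → ℝ, ContDiff ℝ 1 φ → HasCompactSupport φ →
      μ.integral φ (ContinuousLinearMap.lsmul ℝ ℝ) = 0) : μ = 0 := by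
  have hfin : IsFiniteMeasure μ.variation := ⟨hμ⟩
  -- Smooth cutoffs supported in shrinking neighbourhoods converge to the indicator of a compact
  -- set. Exhaustion then reaches closed sets, a π-system generating the Borel sets.
  have hcompact : ∀ s : Set Plane, IsCompact s → μ s = 0 := by
    intro s hs
    obtain ⟨δ, δpos, hδ⟩ : ∃ δ, 0 < δ ∧ IsCompact (Metric.cthickening δ s) :=
      hs.exists_isCompact_cthickening
    obtain ⟨u, -, u_pos, u_lim⟩ : ∃ u, StrictAnti u ∧ (∀ (n : ℕ), u n ∈ Ioo 0 δ)
      ∧ Tendsto u atTop (𝓝 0) := exists_seq_strictAnti_tendsto' δpos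
    have hex : ∀ n, ∃ g : Plane → ℝ, Function.support g = Metric.thickening (u n) s ∧
        ContDiff ℝ 1 g ∧ Set.range g ⊆ Set.Icc 0 1 ∧ ∀ x ∈ s, g x = 1 := by
      intro n
      rcases exists_contMDiff_support_eq_eq_one_iff (modelWithCornersSelf ℝ Plane) (n := 1)
        Metric.isOpen_thickening hs.isClosed
        (Metric.self_subset_thickening (u_pos n).1 s) with ⟨g, g_smooth, g_range, g_supp, hg⟩
      exact ⟨g, g_supp, g_smooth.contDiff, g_range, fun x hx ↦ (hg x).1 hx⟩
    choose g g_supp g_diff g_range hg using hex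
    have hb : ∀ n x, ‖g n x‖ ≤ 1 := fun n x => by
      have := g_range n (mem_range_self (f := g n) x)
      rw [Real.norm_of_nonneg this.1]
      exact this.2
    have L : Tendsto (fun n => μ.integral (g n) (ContinuousLinearMap.lsmul ℝ ℝ)) atTop
        (𝓝 (μ.integral (s.indicator fun _ => 1) (ContinuousLinearMap.lsmul ℝ ℝ))) := by
      refine VectorMeasure.tendsto_integral_of_dominated_convergence (fun _ => 1)
        (fun n => (g_diff n).continuous.aestronglyMeasurable) (integrable_const _)
        (fun n => .of_forall (hb n)) (.of_forall fun x => ?_)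
      by_cases hxs : x ∈ s
      · simp [hg _ x hxs, hxs]
      · rw [indicator_of_notMem hxs]
        apply tendsto_const_nhds.congr'
        obtain ⟨ε, εpos, hε⟩ : ∃ ε, 0 < ε ∧ x ∉ Metric.thickening ε s := by
          rw [← hs.isClosed.closure_eq, Metric.closure_eq_iInter_thickening s] at hxs
          simpa using hxs
        filter_upwards [(tendsto_order.1 u_lim).2 _ εpos] with n hn
        symm
        rw [← Function.notMem_support, g_supp]
        contrapose hε
        exact Metric.thickening_mono hn.le s hε
    have hz : ∀ n, μ.integral (g n) (ContinuousLinearMap.lsmul ℝ ℝ) = 0 := fun n =>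
      h _ (g_diff n) (HasCompactSupport.of_support_subset_isCompact hδ (by
        rw [g_supp]; exact Metric.thickening_subset_cthickening_of_le (u_pos n).2.le _))
    simp only [hz] at L
    rw [VectorMeasure.integral_indicator_const _ hs.measurableSet] at L
    simpa using tendsto_nhds_unique L tendsto_const_nhds
  have hclosed : ∀ s : Set Plane, IsClosed s → μ s = 0 := by
    intro s hs
    have h1 := VectorMeasure.tendsto_vectorMeasure_iUnion_atTop_nat (v := μ)
      (s := fun n : ℕ => s ∩ Metric.closedBall (0 : Plane) n)
      (fun m n hmn => inter_subset_inter_right _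
        (Metric.closedBall_subset_closedBall (by exact_mod_cast hmn)))
      (fun n => (hs.inter Metric.isClosed_closedBall).measurableSet)
    rw [← inter_iUnion, Metric.iUnion_closedBall_nat, inter_univ] at h1
    simp only [hcompact _ ((isCompact_closedBall (0 : Plane) _).inter_left hs)] at h1
    exact tendsto_nhds_unique h1 tendsto_const_nhds
  refine VectorMeasure.ext_of_generateFrom {s | IsClosed s} (fun s hs => ?_) ?_ ?_ ?_
  · rw [hclosed s hs]; simp
  · rw [BorelSpace.measurable_eq (α := Plane), borel_eq_generateFrom_isClosed]
  · exact fun s hs t ht _ => hs.inter ht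
  · rw [hclosed univ isClosed_univ]; simp

/-- `HasOuterNormalAt` quantifies over some gradient measure; uniqueness allows the explicit one of
a polygon to be substituted. -/
lemma IsIndicatorGradient.unique {E : Set Plane} {μ μ' : VectorMeasure Plane Plane}
    (h : IsIndicatorGradient E μ) (h' : IsIndicatorGradient E μ') : μ = μ' := by
  have hfin : IsFiniteMeasure μ.variation := ⟨h.1⟩
  have hfin' : IsFiniteMeasure μ'.variation := ⟨h'.1⟩
  rw [← sub_eq_zero]
  refine eq_zero_of_integral_eq_zero ?_ fun φ hφ hc => ?_
  · exact (VectorMeasure.variation_sub_le univ).trans_lt (ENNReal.add_lt_top.2 ⟨h.1, h'.1⟩)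
  · have h1 : Integrable φ μ.variation := hφ.continuous.integrable_of_hasCompactSupport hc
    have h2 : Integrable φ μ'.variation := hφ.continuous.integrable_of_hasCompactSupport hc
    rw [VectorMeasure.integral_sub_vectorMeasure h1 h2, ← neg_eq_zero, neg_sub,
      sub_eq_neg_add, ← h.2 φ hφ hc, h'.2 φ hφ hc]
    abel

end VectorMeasure

/-! ### The reduced boundary of a convex polygon -/

lemma eq_of_inner_unit {u v : Plane} (h : ∀ e : Plane, ‖e‖ = 1 → inner ℝ e u = inner ℝ e v) :
    u = v := by
  by_contra hne
  have h1 : u - v ≠ 0 := sub_ne_zero.2 hne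
  have h2 := norm_ne_zero_iff.2 h1
  have h3 := h (‖u - v‖⁻¹ • (u - v)) (by rw [norm_smul, norm_inv, norm_norm, inv_mul_cancel₀ h2])
  rw [← sub_eq_zero, ← inner_sub_right, real_inner_smul_left, real_inner_self_eq_norm_sq] at h3
  have : ‖u - v‖⁻¹ * ‖u - v‖ ^ 2 ≠ 0 := by positivity
  exact this h3

lemma inner_gradient (φ : Plane → ℝ) (x e : Plane) :
    inner ℝ e (gradient φ x) = fderiv ℝ φ x e := by
  rw [real_inner_comm, gradient, InnerProductSpace.toDual_symm_apply]

lemma isClosed_edge (N : Finset Plane) (h : Plane → ℝ) (ν : Plane) : IsClosed (edge N h ν) := by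
  have : edge N h ν = {x | inner ℝ x ν = h ν} ∩ ⋂ μ ∈ N, {x | inner ℝ x μ ≤ h μ} := by
    ext x; simp [edge]
  rw [this]
  exact (isClosed_eq (by fun_prop) continuous_const).inter
    (isClosed_biInter fun μ _ => isClosed_le (by fun_prop) continuous_const)

lemma side_disjoint_edge {N : Finset Plane} {h : Plane → ℝ} {ν μ : Plane} (hμ : μ ∈ N)
    (hne : μ ≠ ν) : Disjoint (side N h ν) (edge N h μ) :=
  Set.disjoint_left.2 fun _ hx hx' => (hx.2 μ hμ hne).ne hx'.1

lemma measurableSet_side (N : Finset Plane) (h : Plane → ℝ) (ν : Plane) :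
    MeasurableSet (side N h ν) := by
  classical
  have : side N h ν = {x | inner ℝ x ν = h ν} ∩ ⋂ μ ∈ N.erase ν, {x | inner ℝ x μ < h μ} := by
    ext x; simp [side]; tauto
  rw [this]
  exact (isClosed_eq (by fun_prop) continuous_const).measurableSet.inter
    (Finset.measurableSet_biInter _ fun μ _ =>
      (isOpen_lt (by fun_prop) continuous_const).measurableSet)

namespace IsReducedPolygon

variable {N : Finset Plane} {h : Plane → ℝ} {E : Set Plane} (hE : IsReducedPolygon N h E)
include hE

lemma exists_param : ∃ lo hi : Plane → ℝ, ∀ ν ∈ N, lo ν < hi ν ∧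
    edge N h ν = linePt h ν '' Icc (lo ν) (hi ν) ∧
    side N h ν = linePt h ν '' Ioo (lo ν) (hi ν) := by
  obtain ⟨σ, hσ⟩ := exists_isCyclicNext hE.unit fun ν hν => hE.exists_cross_pos hν
  obtain ⟨lo, hi, hpar, -⟩ := hE.exists_edge_param hσ
  exact ⟨lo, hi, hpar⟩

lemma edge_lt_top {ν : Plane} (hν : ν ∈ N) : (μH[1] : Measure Plane) (edge N h ν) < ∞ := by
  obtain ⟨lo, hi, hpar⟩ := hE.exists_param
  rw [(hpar ν hν).2.1, hausdorff_image_linePt h (hE.unit ν hν), Real.volume_Icc]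
  exact ENNReal.ofReal_lt_top

lemma side_ae_eq_edge {ν : Plane} (hν : ν ∈ N) :
    side N h ν =ᵐ[(μH[1] : Measure Plane)] edge N h ν := by
  obtain ⟨lo, hi, hpar⟩ := hE.exists_param
  obtain ⟨h1, h2, h3⟩ := hpar ν hν
  refine ae_eq_of_subset_of_measure_ge side_subset_edge ?_
    (measurableSet_side N h ν).nullMeasurableSet (hE.edge_lt_top hν).ne
  rw [h2, h3, hausdorff_image_linePt h (hE.unit ν hν), hausdorff_image_linePt h (hE.unit ν hν),
    Real.volume_Icc, Real.volume_Ioo]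

lemma integrableOn_edge {ν : Plane} (hν : ν ∈ N) {φ : Plane → ℝ} (hφ : Continuous φ) :
    IntegrableOn φ (edge N h ν) μH[1] := by
  obtain ⟨lo, hi, hpar⟩ := hE.exists_param
  rw [IntegrableOn, (hpar ν hν).2.1, hausdorff_restrict_linePt h (hE.unit ν hν),
    (isometry_linePt h (hE.unit ν hν)).isClosedEmbedding.measurableEmbedding.integrable_map_iff]
  exact (hφ.comp (isometry_linePt h (hE.unit ν hν)).continuous).continuousOn.integrableOn_Icc

/-- The gradient of the indicator function of a polygon is `-∑ ν ℋ¹|edge`. -/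
lemma exists_isIndicatorGradient : ∃ μ : VectorMeasure Plane Plane, IsIndicatorGradient E μ ∧
    (∀ A, MeasurableSet A → μ A = -∑ ν ∈ N, (μH[1] : Measure Plane).real (A ∩ edge N h ν) • ν) ∧
    ∀ A, MeasurableSet A → μ.variation A = ∑ ν ∈ N, (μH[1] : Measure Plane) (A ∩ edge N h ν) := by
  classical
  set m : Plane → Measure Plane := fun ν =>
    if ν ∈ N then (μH[1] : Measure Plane).restrict (edge N h ν) else 0 with hm
  have hmν : ∀ ν ∈ N, m ν = (μH[1] : Measure Plane).restrict (edge N h ν) := fun ν hν => if_pos hν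
  have hfin : ∀ ν, IsFiniteMeasure (m ν) := fun ν => by
    by_cases hν : ν ∈ N
    · rw [hmν ν hν]; exact ⟨by simpa using hE.edge_lt_top hν⟩
    · simp only [hm, if_neg hν]; infer_instance
  set μ : VectorMeasure Plane Plane := ∑ ν ∈ N, smulMeasure (m ν) (-ν) with hμ
  have happ : ∀ A, MeasurableSet A →
      μ A = -∑ ν ∈ N, (μH[1] : Measure Plane).real (A ∩ edge N h ν) • ν := by
    intro A hA
    have : μ A = ∑ ν ∈ N, smulMeasure (m ν) (-ν) A := by
      rw [hμ]
      simp
    rw [this, ← Finset.sum_neg_distrib]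
    refine Finset.sum_congr rfl fun ν hν => ?_
    rw [smulMeasure_apply _ _ hA, hmν ν hν, measureReal_restrict_apply hA, smul_neg]
  have hle : μ.variation ≤ ∑ ν ∈ N, m ν := by
    refine (VectorMeasure.variation_finsetSum_le N _).trans ?_
    refine Finset.sum_le_sum fun ν hν => (variation_smulMeasure_le _ _).trans ?_
    have : ‖-ν‖₊ = 1 := by
      rw [nnnorm_neg]; exact NNReal.eq (hE.unit ν hν)
    rw [this, one_smul]
  have hvar : ∀ A, MeasurableSet A →
      μ.variation A = ∑ ν ∈ N, (μH[1] : Measure Plane) (A ∩ edge N h ν) := by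
    intro A hA
    apply le_antisymm
    · refine (hle A).trans_eq ?_
      rw [Measure.finsetSum_apply]
      exact Finset.sum_congr rfl fun ν hν => by rw [hmν ν hν, Measure.restrict_apply hA]
    -- The open sides are disjoint, and on each of them the measure is a constant unit vector times
    -- ℋ¹, so no mass cancels.
    · have hms : ∀ ν ∈ N, MeasurableSet (A ∩ side N h ν) := fun ν _ =>
        hA.inter (measurableSet_side N h ν)
      calc ∑ ν ∈ N, (μH[1] : Measure Plane) (A ∩ edge N h ν)
          ≤ ∑ ν ∈ N, μ.variation (A ∩ side N h ν) := by
            refine Finset.sum_le_sum fun ν hν => ?_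
            refine le_trans (le_of_eq ?_) (VectorMeasure.enorm_measure_le_variation μ _)
            rw [happ _ (hms ν hν), enorm_neg, Finset.sum_eq_single_of_mem ν hν]
            · have h1 : A ∩ side N h ν ∩ edge N h ν = A ∩ side N h ν := by
                rw [inter_assoc, inter_eq_self_of_subset_left side_subset_edge]
              have h2 : (μH[1] : Measure Plane) (A ∩ side N h ν) < ∞ :=
                (measure_mono (inter_subset_right.trans side_subset_edge)).trans_lt
                  (hE.edge_lt_top hν)
              rw [h1, enorm_smul, Real.enorm_of_nonneg measureReal_nonneg,
                ofReal_measureReal h2.ne, ← ofReal_norm, hE.unit ν hν, ENNReal.ofReal_one,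
                mul_one]
              exact measure_congr ((ae_eq_refl A).inter (hE.side_ae_eq_edge hν).symm)
            · intro μ' hμ' hne
              have h1 : A ∩ side N h ν ∩ edge N h μ' = ∅ := by
                rw [inter_assoc, (side_disjoint_edge hμ' hne).inter_eq, inter_empty]
              rw [h1]; simp
        _ = μ.variation (⋃ ν ∈ N, A ∩ side N h ν) := by
            rw [measure_biUnion_finset _ hms]
            intro ν hν μ' hμ' hne
            exact ((side_disjoint_edge hμ' hne.symm).mono_right side_subset_edge).mono
              inter_subset_right inter_subset_right
        _ ≤ μ.variation A := measure_mono (iUnion₂_subset fun _ _ => inter_subset_left)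
  refine ⟨μ, ⟨?_, fun φ hφ hc => ?_⟩, happ, hvar⟩
  · rw [hvar univ MeasurableSet.univ]
    exact ENNReal.sum_lt_top.2 fun ν hν => by rw [univ_inter]; exact hE.edge_lt_top hν
  · have hint : ∀ ν ∈ N, Integrable φ (m ν) := fun ν hν => by
      rw [hmν ν hν]; exact hE.integrableOn_edge hν hφ.continuous
    have h1 : μ.integral φ (ContinuousLinearMap.lsmul ℝ ℝ) =
        ∑ ν ∈ N, (∫ x in edge N h ν, φ x ∂μH[1]) • (-ν) := by
      rw [hμ, VectorMeasure.integral_finsetSum_vectorMeasure]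
      · refine Finset.sum_congr rfl fun ν hν => ?_
        rw [integral_smulMeasure _ _ (hint ν hν), hmν ν hν]
      · intro ν hν
        refine Integrable.mono_measure ((hint ν hν).smul_measure_nnreal (c := ‖-ν‖₊)) ?_
        exact variation_smulMeasure_le _ _
    have hgrad : Continuous (gradient φ) :=
      (InnerProductSpace.toDual ℝ Plane).symm.continuous.comp (hφ.continuous_fderiv one_ne_zero)
    obtain ⟨R, hR⟩ := hE.bounded.exists_norm_le
    have hgi : IntegrableOn (gradient φ) E :=
      (hgrad.locallyIntegrable.integrableOn_isCompact
        (isCompact_closedBall (0 : Plane) R)).mono_set fun x hx => by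
          rw [mem_closedBall_zero_iff]; exact hR x hx
    rw [h1]
    refine eq_of_inner_unit fun e he => ?_
    rw [← integral_inner hgi e]
    simp only [inner_gradient]
    rw [hE.integral_fderiv hφ he, inner_neg_right, inner_sum, ← Finset.sum_neg_distrib]
    refine Finset.sum_congr rfl fun ν _ => ?_
    rw [real_inner_smul_right, inner_neg_right]
    ring

/-- With `le_edge_inter_ball`, this shows that each edge through `x` carries a fixed fraction of the
variation in small balls. -/
lemma edge_inter_ball_le {ν : Plane} (hν : ν ∈ N) (x : Plane) (r : ℝ) :
    (μH[1] : Measure Plane) (Metric.ball x r ∩ edge N h ν) ≤ ENNReal.ofReal (4 * r) := by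
  obtain ⟨lo, hi, hpar⟩ := hE.exists_param
  rw [(hpar ν hν).2.1]
  by_cases hne : ∃ s₀, linePt h ν s₀ ∈ Metric.ball x r
  · obtain ⟨s₀, hs₀⟩ := hne
    have hsub : Metric.ball x r ∩ linePt h ν '' Icc (lo ν) (hi ν) ⊆
        linePt h ν '' Icc (s₀ - 2 * r) (s₀ + 2 * r) := by
      rintro _ ⟨h1, s, -, rfl⟩
      refine ⟨s, ?_, rfl⟩
      have h2 : dist (linePt h ν s) (linePt h ν s₀) ≤ 2 * r := by
        rw [Metric.mem_ball] at h1 hs₀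
        have := dist_triangle_right (linePt h ν s) (linePt h ν s₀) x
        linarith
      rw [dist_linePt h (hE.unit ν hν), abs_le] at h2
      constructor <;> linarith
    refine (measure_mono hsub).trans ?_
    rw [hausdorff_image_linePt h (hE.unit ν hν), Real.volume_Icc]
    exact ENNReal.ofReal_le_ofReal (by linarith)
  · have : Metric.ball x r ∩ linePt h ν '' Icc (lo ν) (hi ν) = ∅ := by
      ext y
      refine ⟨?_, fun h => h.elim⟩
      rintro ⟨h1, s, -, rfl⟩
      exact hne ⟨s, h1⟩
    rw [this]; simp

/-- End points are included: up to half the edge length, a segment of length `r` from `x` fits in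
the edge on at least one side. -/
lemma le_edge_inter_ball {ν : Plane} (hν : ν ∈ N) {x : Plane} (hx : x ∈ edge N h ν) :
    ∃ ρ > 0, ∀ r, 0 < r → r ≤ ρ →
      ENNReal.ofReal r ≤ (μH[1] : Measure Plane) (Metric.ball x r ∩ edge N h ν) := by
  obtain ⟨lo, hi, hpar⟩ := hE.exists_param
  obtain ⟨hlt, h2, -⟩ := hpar ν hν
  rw [h2] at hx ⊢
  obtain ⟨s₀, hs₀, rfl⟩ := hx
  refine ⟨(hi ν - lo ν) / 2, by linarith, fun r hr hle => ?_⟩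
  have key : ∀ a, |a - s₀| ≤ r → |a + r - s₀| ≤ r → lo ν ≤ a → a + r ≤ hi ν → ENNReal.ofReal r ≤
      (μH[1] : Measure Plane) (Metric.ball (linePt h ν s₀) r ∩ linePt h ν '' Icc (lo ν) (hi ν)) := by
    intro a h3 h4 h5 h6
    rw [abs_le] at h3 h4
    have hsub : linePt h ν '' Ioo a (a + r) ⊆
        Metric.ball (linePt h ν s₀) r ∩ linePt h ν '' Icc (lo ν) (hi ν) := by
      rintro _ ⟨s, hs, rfl⟩
      refine ⟨?_, s, ⟨by linarith [hs.1], by linarith [hs.2]⟩, rfl⟩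
      rw [Metric.mem_ball, dist_linePt h (hE.unit ν hν), abs_lt]
      constructor <;> linarith [hs.1, hs.2]
    refine le_trans (le_of_eq ?_) (measure_mono hsub)
    rw [hausdorff_image_linePt h (hE.unit ν hν), Real.volume_Ioo, add_sub_cancel_left]
  by_cases hmid : s₀ + r ≤ hi ν
  · exact key s₀ (by simp [hr.le]) (by simp [abs_of_pos hr]) hs₀.1 hmid
  · exact key (s₀ - r) (by simp [abs_of_pos hr]) (by simp [hr.le]) (by linarith [hs₀.2])
      (by linarith [hs₀.2])

/-- Small balls around `x` meet no other edge, so the De Giorgi quotient is constantly `-ν`. -/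
lemma hasOuterNormalAt_of_mem_side {ν x : Plane} (hν : ν ∈ N) (hx : x ∈ side N h ν) :
    HasOuterNormalAt E x ν := by
  obtain ⟨μ, hμ, happ, hvar⟩ := hE.exists_isIndicatorGradient
  obtain ⟨ρ, hρ, hle⟩ := hE.le_edge_inter_ball hν (side_subset_edge hx)
  refine ⟨μ, hμ, fun r hr => ?_, hE.unit ν hν, ?_⟩
  · have h1 : 0 < min r ρ := lt_min hr hρ
    refine lt_of_lt_of_le (ENNReal.ofReal_pos.2 h1) ((hle _ h1 (min_le_right _ _)).trans ?_)
    refine le_trans ?_ (measure_mono (Metric.ball_subset_ball (min_le_left r ρ)))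
    rw [hvar _ Metric.isOpen_ball.measurableSet]
    exact Finset.single_le_sum
      (f := fun ν => (μH[1] : Measure Plane) (Metric.ball x (min r ρ) ∩ edge N h ν))
      (fun _ _ => zero_le) hν
  · have hev : ∀ᶠ r in 𝓝[>] (0 : ℝ), ∀ μ' ∈ N, μ' ≠ ν → Metric.ball x r ∩ edge N h μ' = ∅ := by
      rw [Filter.eventually_all_finset]
      intro μ' hμ'
      by_cases hne : μ' = ν
      · exact .of_forall fun _ h => absurd hne h
      have h1 : x ∈ (edge N h μ')ᶜ := Set.disjoint_left.1 (side_disjoint_edge hμ' hne) hx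
      obtain ⟨ε, hε, hsub⟩ := Metric.isOpen_iff.1 (isClosed_edge N h μ').isOpen_compl x h1
      filter_upwards [Ioo_mem_nhdsGT hε] with r hr _
      rw [← Set.disjoint_iff_inter_eq_empty]
      exact Set.disjoint_left.2 fun y hy => hsub (Metric.ball_subset_ball hr.2.le hy)
    refine tendsto_const_nhds.congr' ?_
    filter_upwards [hev, Ioo_mem_nhdsGT hρ] with r hr hrρ
    have hball : MeasurableSet (Metric.ball x r) := Metric.isOpen_ball.measurableSet
    have h2 := hle r hrρ.1 hrρ.2.le
    have h3 : μ.variation.real (Metric.ball x r) =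
        (μH[1] : Measure Plane).real (Metric.ball x r ∩ edge N h ν) := by
      rw [Measure.real, hvar _ hball, Finset.sum_eq_single_of_mem ν hν fun μ' hμ' hne => by
        rw [hr μ' hμ' hne, measure_empty]]
      rfl
    have h4 : (μH[1] : Measure Plane).real (Metric.ball x r ∩ edge N h ν) ≠ 0 := by
      have h5 := (measure_mono (inter_subset_right (s := Metric.ball x r))).trans_lt
        (hE.edge_lt_top hν)
      exact (ENNReal.toReal_pos ((ENNReal.ofReal_pos.2 hrρ.1).trans_le h2).ne' h5.ne).ne'
    rw [h3, happ _ hball, Finset.sum_eq_single_of_mem ν hν fun μ' hμ' hne => by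
        rw [hr μ' hμ' hne, measureReal_empty, zero_smul], smul_neg, smul_smul,
      inv_mul_cancel₀ h4, one_smul]

lemma mem_edge_of_hasOuterNormalAt {ν x : Plane} (hx : HasOuterNormalAt E x ν) :
    ∃ μ ∈ N, x ∈ edge N h μ := by
  obtain ⟨μ, hμ, -, hvar⟩ := hE.exists_isIndicatorGradient
  obtain ⟨μ', hμ', hpos, -⟩ := hx
  rw [hμ'.unique hμ] at hpos
  by_contra! hcon
  have h1 : IsOpen (⋂ ν ∈ N, (edge N h ν)ᶜ) :=
    isOpen_biInter_finset fun ν _ => (isClosed_edge N h ν).isOpen_compl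
  obtain ⟨ε, hε, hsub⟩ := Metric.isOpen_iff.1 h1 x (by simpa using hcon)
  refine (hpos ε hε).ne' ?_
  rw [hvar _ Metric.isOpen_ball.measurableSet]
  refine Finset.sum_eq_zero fun ν hν => ?_
  have : Metric.ball x ε ∩ edge N h ν = ∅ := by
    rw [← Set.disjoint_iff_inter_eq_empty]
    exact Set.disjoint_left.2 fun y hy => (Set.mem_iInter₂.1 (hsub hy)) ν hν
  rw [this, measure_empty]

/-- At any point of an edge with normal `ν` the outer normal, if it exists, is `ν`. -/
lemma outerNormal_unique_of_mem_edge {ν n x : Plane} (hν : ν ∈ N) (hx : x ∈ edge N h ν)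
    (hn : HasOuterNormalAt E x n) : n = ν := by
  obtain ⟨μ, hμ, happ, hvar⟩ := hE.exists_isIndicatorGradient
  obtain ⟨μ', hμ', hpos, hn1, hlim⟩ := hn
  rw [hμ'.unique hμ] at hlim hpos
  obtain ⟨ρ, hρ, hle⟩ := hE.le_edge_inter_ball hν hx
  have hlim2 := (hlim.inner (𝕜 := ℝ) (tendsto_const_nhds (x := -n)))
  rw [inner_neg_neg, real_inner_self_eq_norm_sq, hn1, one_pow] at hlim2
  have hcs : ∀ μ ∈ N, 0 ≤ 1 - inner ℝ μ n := fun μ hμ => by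
    have := real_inner_le_norm μ n
    rw [hE.unit μ hμ, hn1] at this
    linarith
  -- The quotient paired with `-n` is a weighted mean of the numbers `inner ℝ μ n ≤ 1`, in which `ν`
  -- has weight at least `1 / (4 * N.card)`. As the limit is 1, the defect of `ν` must vanish.
  have hkey : 1 ≤ 1 - (1 - inner ℝ ν n) / (4 * N.card) := by
    refine le_of_tendsto hlim2 ?_
    filter_upwards [Ioo_mem_nhdsGT hρ] with r hr
    have hball : MeasurableSet (Metric.ball x r) := Metric.isOpen_ball.measurableSet
    set M := fun μ => (μH[1] : Measure Plane).real (Metric.ball x r ∩ edge N h μ) with hM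
    have hfin : ∀ μ ∈ N, (μH[1] : Measure Plane) (Metric.ball x r ∩ edge N h μ) ≠ ∞ :=
      fun μ hμ => ((measure_mono inter_subset_right).trans_lt (hE.edge_lt_top hμ)).ne
    have hW : μ.variation.real (Metric.ball x r) = ∑ μ ∈ N, M μ := by
      rw [Measure.real, hvar _ hball, ENNReal.toReal_sum hfin]
      rfl
    have hM0 : ∀ μ ∈ N, 0 ≤ M μ := fun _ _ => measureReal_nonneg
    have hMr : r ≤ M ν := by
      have := ENNReal.toReal_mono (hfin ν hν) (hle r hr.1 hr.2.le)
      rwa [ENNReal.toReal_ofReal hr.1.le] at this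
    have hM4 : ∑ μ ∈ N, M μ ≤ 4 * N.card * r := by
      calc ∑ μ ∈ N, M μ ≤ ∑ μ ∈ N, 4 * r := Finset.sum_le_sum fun μ hμ => by
            have := ENNReal.toReal_mono ENNReal.ofReal_ne_top (hE.edge_inter_ball_le hμ x r)
            rwa [ENNReal.toReal_ofReal (by linarith [hr.1])] at this
        _ = 4 * N.card * r := by rw [Finset.sum_const, nsmul_eq_mul]; ring
    have hWpos : 0 < ∑ μ ∈ N, M μ := hr.1.trans_le (hMr.trans (Finset.single_le_sum hM0 hν))
    have hcard : (0 : ℝ) < N.card := by exact_mod_cast Finset.card_pos.2 ⟨ν, hν⟩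
    rw [hW, happ _ hball, smul_neg, inner_neg_neg, real_inner_smul_left, sum_inner]
    simp only [real_inner_smul_left]
    rw [inv_mul_le_iff₀ hWpos]
    have h1 : ∑ μ ∈ N, M μ * inner ℝ μ n = ∑ μ ∈ N, M μ - ∑ μ ∈ N, M μ * (1 - inner ℝ μ n) := by
      rw [← Finset.sum_sub_distrib]
      exact Finset.sum_congr rfl fun μ _ => by ring
    have h2 : M ν * (1 - inner ℝ ν n) ≤ ∑ μ ∈ N, M μ * (1 - inner ℝ μ n) :=
      Finset.single_le_sum (f := fun μ => M μ * (1 - inner ℝ μ n))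
        (fun μ hμ => mul_nonneg (hM0 μ hμ) (hcs μ hμ)) hν
    have h3 : (∑ μ ∈ N, M μ) * ((1 - inner ℝ ν n) / (4 * N.card)) ≤ M ν * (1 - inner ℝ ν n) := by
      rw [mul_div_assoc', div_le_iff₀ (by positivity)]
      have h4 : ∑ μ ∈ N, M μ ≤ M ν * (4 * N.card) := by
        nlinarith [mul_le_mul_of_nonneg_left hMr hcard.le]
      nlinarith [mul_le_mul_of_nonneg_right h4 (hcs ν hν)]
    simp only [hM] at h1 h2 h3 ⊢
    rw [h1]
    linarith
  have hcard : (0 : ℝ) < N.card := by exact_mod_cast Finset.card_pos.2 ⟨ν, hν⟩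
  have h5 : (1 - inner ℝ ν n) / (4 * N.card) ≤ 0 := by linarith
  have h6 : inner ℝ ν n = 1 := by
    rw [div_le_iff₀ (by positivity), zero_mul] at h5
    linarith [hcs ν hν]
  exact ((inner_eq_one_iff_of_norm_eq_one (hE.unit ν hν) hn1).1 h6).symm

/-- At a vertex a normal would have to equal those of both adjacent edges, so vertices are not in
the reduced boundary. -/
lemma hasOuterNormalAt_iff {ν x : Plane} : HasOuterNormalAt E x ν ↔ ν ∈ N ∧ x ∈ side N h ν := by
  refine ⟨fun hx => ?_, fun hx => hE.hasOuterNormalAt_of_mem_side hx.1 hx.2⟩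
  obtain ⟨μ, hμ, hxμ⟩ := hE.mem_edge_of_hasOuterNormalAt hx
  have h1 := hE.outerNormal_unique_of_mem_edge hμ hxμ hx
  subst h1
  refine ⟨hμ, hxμ.1, fun μ' hμ' hne => lt_of_le_of_ne (hxμ.2 μ' hμ') fun heq => hne ?_⟩
  exact (hE.outerNormal_unique_of_mem_edge hμ' ⟨heq, hxμ.2⟩ hx).symm

lemma reducedBoundary_eq : reducedBoundary E = ⋃ ν ∈ N, side N h ν := by
  ext x
  simp [reducedBoundary, hE.hasOuterNormalAt_iff]

lemma outerNormal_eq {ν x : Plane} (hν : ν ∈ N) (hx : x ∈ side N h ν) : outerNormal E x = ν := by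
  have hex : ∃ ν, HasOuterNormalAt E x ν := ⟨ν, hE.hasOuterNormalAt_of_mem_side hν hx⟩
  rw [outerNormal, dif_pos hex]
  exact hE.outerNormal_unique_of_mem_edge hν (side_subset_edge hx) hex.choose_spec

lemma normals_eq : normals E = N := by
  ext ν
  constructor
  · rintro ⟨x, hx, rfl⟩
    rw [hE.reducedBoundary_eq] at hx
    obtain ⟨ν, hν, hxν⟩ := Set.mem_iUnion₂.1 hx
    rw [hE.outerNormal_eq hν hxν]
    exact hν
  · intro hν
    obtain ⟨p, hp⟩ : (side N h ν).Nonempty := hE.facet ν hν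
    refine ⟨p, ?_, hE.outerNormal_eq hν hp⟩
    rw [hE.reducedBoundary_eq]
    exact Set.mem_iUnion₂.2 ⟨ν, hν, hp⟩

lemma setIntegral_reducedBoundary {G : Plane → Plane → ℝ}
    (hG : ∀ ν ∈ N, IntegrableOn (fun x => G x ν) (edge N h ν) μH[1]) :
    ∫ x in reducedBoundary E, G x (outerNormal E x) ∂μH[1] =
      ∑ ν ∈ N, ∫ x in edge N h ν, G x ν ∂μH[1] := by
  have hcongr : ∀ ν ∈ N, EqOn (fun x => G x ν) (fun x => G x (outerNormal E x)) (side N h ν) :=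
    fun ν hν x hx => by simp only [hE.outerNormal_eq hν hx]
  rw [hE.reducedBoundary_eq, integral_biUnion_finset N (fun ν _ => measurableSet_side N h ν)]
  · refine Finset.sum_congr rfl fun ν hν => ?_
    rw [← setIntegral_congr_fun (measurableSet_side N h ν) (hcongr ν hν),
      setIntegral_congr_set (hE.side_ae_eq_edge hν)]
  · intro ν hν μ hμ hne
    exact (side_disjoint_edge hμ hne.symm).mono_right side_subset_edge
  · intro ν hν
    exact ((hG ν hν).mono_set side_subset_edge).congr_fun (hcongr ν hν) (measurableSet_side N h ν)

end IsReducedPolygon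

/-! ### Area and surface energy through the mixed area form -/

namespace IsReducedPolygon

variable {N : Finset Plane} {h : Plane → ℝ} {E : Set Plane} (hE : IsReducedPolygon N h E)
include hE

lemma sum_mul_length {σ : Plane → Plane} (hσ : IsCyclicNext N σ) (w : Plane → ℝ) :
    ∑ ν ∈ N, w ν * (μH[1] : Measure Plane).real (edge N h ν) = mixedForm N σ h w := by
  obtain ⟨lo, hi, hpar, hsum⟩ := hE.exists_edge_param hσ
  rw [← hsum]
  refine Finset.sum_congr rfl fun ν hν => ?_
  rw [Measure.real, (hpar ν hν).2.1, hausdorff_image_linePt h (hE.unit ν hν), Real.volume_Icc,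
    ENNReal.toReal_ofReal (by linarith [(hpar ν hν).1])]

lemma length_pos {ν : Plane} (hν : ν ∈ N) :
    0 < (μH[1] : Measure Plane).real (edge N h ν) := by
  obtain ⟨lo, hi, hpar⟩ := hE.exists_param
  rw [Measure.real, (hpar ν hν).2.1, hausdorff_image_linePt h (hE.unit ν hν), Real.volume_Icc,
    ENNReal.toReal_ofReal (by linarith [(hpar ν hν).1])]
  linarith [(hpar ν hν).1]

/-- Twice the area of a polygon is the sum of edge lengths times support numbers. -/
lemma two_mul_volume {σ : Plane → Plane} (hσ : IsCyclicNext N σ) :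
    2 * volume.real E = mixedForm N σ h h := by
  have key : ∀ e : Plane, ‖e‖ = 1 → volume.real E =
      ∑ ν ∈ N, ∫ x in edge N h ν, inner ℝ e ν * inner ℝ e x ∂μH[1] := by
    intro e he
    have h1 := hE.integral_fderiv (φ := fun x => inner ℝ e x)
      (contDiff_const.inner ℝ contDiff_id) he
    have h2 : ∀ x : Plane, fderiv ℝ (fun x : Plane => inner ℝ e x) x e = 1 := fun x => by
      have h3 : fderiv ℝ (fun x : Plane => inner ℝ e x) x = innerSL ℝ e :=
        (innerSL ℝ e).fderiv
      rw [h3, innerSL_apply_apply, real_inner_self_eq_norm_sq, he, one_pow]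
    simp only [h2, setIntegral_const, smul_eq_mul, mul_one] at h1
    rw [h1]
    exact Finset.sum_congr rfl fun ν _ => (integral_const_mul _ _).symm
  have he0 : ‖(!₂[1, 0] : Plane)‖ = 1 := by
    have h1 : ‖(!₂[1, 0] : Plane)‖ ^ 2 = 1 := by rw [norm_sq_eq]; simp
    exact (pow_eq_one_iff_of_nonneg (norm_nonneg _) two_ne_zero).1 h1
  have he1 : ‖(!₂[0, 1] : Plane)‖ = 1 := by
    have h1 : ‖(!₂[0, 1] : Plane)‖ ^ 2 = 1 := by rw [norm_sq_eq]; simp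
    exact (pow_eq_one_iff_of_nonneg (norm_nonneg _) two_ne_zero).1 h1
  -- Each of two orthonormal directions gives the area once; their sum has integrand `inner ℝ x ν`,
  -- which is `h ν` on the edge.
  have hsum : 2 * volume.real E = ∑ ν ∈ N, ∫ x in edge N h ν,
      (inner ℝ (!₂[1, 0] : Plane) ν * inner ℝ (!₂[1, 0] : Plane) x +
        inner ℝ (!₂[0, 1] : Plane) ν * inner ℝ (!₂[0, 1] : Plane) x) ∂μH[1] := by
    have h3 : ∀ ν ∈ N, ∫ x in edge N h ν,
      (inner ℝ (!₂[1, 0] : Plane) ν * inner ℝ (!₂[1, 0] : Plane) x +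
        inner ℝ (!₂[0, 1] : Plane) ν * inner ℝ (!₂[0, 1] : Plane) x) ∂μH[1] = _ :=
      fun ν hν => integral_add (hE.integrableOn_edge hν (by fun_prop))
        (hE.integrableOn_edge hν (by fun_prop))
    rw [Finset.sum_congr rfl h3, Finset.sum_add_distrib, ← key _ he0, ← key _ he1, two_mul]
  rw [hsum, ← hE.sum_mul_length hσ]
  refine Finset.sum_congr rfl fun ν hν => ?_
  have h4 : EqOn (fun x => inner ℝ (!₂[1, 0] : Plane) ν * inner ℝ (!₂[1, 0] : Plane) x +
        inner ℝ (!₂[0, 1] : Plane) ν * inner ℝ (!₂[0, 1] : Plane) x) (fun _ => h ν)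
      (edge N h ν) := by
    intro x hx
    rw [← hx.1]
    simp only [inner_eq]
    simp
    ring
  rw [setIntegral_congr_fun (isClosed_edge N h ν).measurableSet h4, setIntegral_const, smul_eq_mul,
    mul_comm]

lemma surfaceEnergy_eq {σ : Plane → Plane} (hσ : IsCyclicNext N σ) (f : Plane → ℝ) :
    surfaceEnergy f E = mixedForm N σ h f := by
  have hfin : ∀ ν ∈ N, IsFiniteMeasure ((μH[1] : Measure Plane).restrict (edge N h ν)) :=
    fun ν hν => ⟨by simpa using hE.edge_lt_top hν⟩
  rw [surfaceEnergy, hE.setIntegral_reducedBoundary (G := fun _ ν => f ν), ← hE.sum_mul_length hσ]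
  · refine Finset.sum_congr rfl fun ν _ => ?_
    rw [setIntegral_const, smul_eq_mul, mul_comm]
  · intro ν hν
    have := hfin ν hν
    exact integrable_const _

end IsReducedPolygon

/-! ### The Wulff shape of a crystalline surface tension -/

section WulffShape

variable {f : Plane → ℝ} (hf : IsSurfaceTension f)
include hf

lemma IsSurfaceTension.map_zero : f 0 = 0 := by
  have := hf.homogeneous 2 0 two_pos
  rw [smul_zero] at this
  linarith

lemma IsSurfaceTension.eq_norm_mul {v : Plane} (hv : v ≠ 0) : f v = ‖v‖ * f (‖v‖⁻¹ • v) := by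
  have h1 := norm_pos_iff.2 hv
  rw [← hf.homogeneous _ _ h1, smul_smul, mul_inv_cancel₀ h1.ne', one_smul]

omit hf in
lemma norm_inv_smul {v : Plane} (hv : v ≠ 0) : ‖‖v‖⁻¹ • v‖ = 1 := by
  rw [norm_smul, norm_inv, norm_norm, inv_mul_cancel₀ (norm_ne_zero_iff.2 hv)]

omit hf in
lemma inner_eq_norm_mul (x : Plane) {v : Plane} (hv : v ≠ 0) :
    inner ℝ x v = ‖v‖ * inner ℝ x (‖v‖⁻¹ • v) := by
  rw [real_inner_smul_right, ← mul_assoc, mul_inv_cancel₀ (norm_ne_zero_iff.2 hv), one_mul]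

lemma IsSurfaceTension.pos {v : Plane} (hv : v ≠ 0) : 0 < f v := by
  rw [hf.eq_norm_mul hv]
  exact mul_pos (norm_pos_iff.2 hv) (hf.pos_on_sphere _ (norm_inv_smul hv))

variable {s : Finset Plane}
  (hs : ∀ ν : Plane, ‖ν‖ = 1 → IsGreatest ((fun x : Plane => inner ℝ x ν) '' (s : Set Plane)) (f ν))
include hs

lemma inner_le_of_isGreatest {x : Plane} (hx : x ∈ s) {v : Plane} (hv : v ≠ 0) :
    inner ℝ x v ≤ f v := by
  rw [hf.eq_norm_mul hv, inner_eq_norm_mul x hv]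
  gcongr
  exact (hs _ (norm_inv_smul hv)).2 ⟨x, hx, rfl⟩

lemma exists_inner_eq_of_isGreatest {v : Plane} (hv : v ≠ 0) : ∃ x ∈ s, inner ℝ x v = f v := by
  obtain ⟨x, hx, h⟩ := (hs _ (norm_inv_smul hv)).1
  refine ⟨x, hx, ?_⟩
  rw [hf.eq_norm_mul hv, inner_eq_norm_mul x hv, ← h]

/-- Rotating `μ` towards `d` until a second generator of `f` becomes active. -/
lemma exists_second_active {μ d j : Plane} (hjs : j ∈ s) (hμ : μ ≠ 0) (hj : inner ℝ j μ = f μ)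
    (hd : d ≠ 0) (hjd : inner ℝ j d = 0) :
    ∃ t : ℝ, 0 ≤ t ∧ μ + t • d ≠ 0 ∧ inner ℝ j (μ + t • d) = f (μ + t • d) ∧
      ∃ i ∈ s, i ≠ j ∧ inner ℝ (j - i) (μ + t • d) = 0 := by
  have hex : ∃ i ∈ s, 0 < inner ℝ i d := by
    obtain ⟨i, hi, h⟩ := exists_inner_eq_of_isGreatest hf hs hd
    exact ⟨i, hi, h ▸ hf.pos hd⟩
  obtain ⟨i, hi, hmin⟩ := Finset.exists_min_image (s.filter fun i => 0 < inner ℝ i d)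
    (fun i => inner ℝ (j - i) μ / inner ℝ i d)
    (by obtain ⟨i, hi, h⟩ := hex; exact ⟨i, Finset.mem_filter.2 ⟨hi, h⟩⟩)
  simp only [Finset.mem_filter, and_imp] at hi hmin
  obtain ⟨his, hid⟩ := hi
  have hnn : ∀ i ∈ s, 0 ≤ inner ℝ (j - i) μ := fun i hi => by
    rw [inner_sub_left, hj]
    linarith [inner_le_of_isGreatest hf hs hi hμ]
  -- Along the ray the value of `j` is constant, and `t` is the first time another generator catches
  -- up with it; one must, because `f d > 0`.
  set t := inner ℝ (j - i) μ / inner ℝ i d with ht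
  have ht0 : 0 ≤ t := div_nonneg (hnn i his) hid.le
  have hjv : inner ℝ j (μ + t • d) = f μ := by
    rw [inner_add_right, real_inner_smul_right, hjd, hj]; ring
  have hv : μ + t • d ≠ 0 := fun h => by
    rw [h, inner_zero_right] at hjv
    exact (hf.pos hμ).ne hjv
  have hle : ∀ i' ∈ s, inner ℝ i' (μ + t • d) ≤ inner ℝ j (μ + t • d) := by
    intro i' hi'
    have h1 := hnn i' hi'
    rw [hjv, ← hj, inner_add_right, real_inner_smul_right]
    rw [inner_sub_left] at h1
    by_cases h2 : 0 < inner ℝ i' d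
    · have h3 := hmin i' hi' h2
      rw [le_div_iff₀ h2, inner_sub_left] at h3
      linarith
    · have := mul_nonneg ht0 (neg_nonneg.2 (not_lt.1 h2))
      linarith
  refine ⟨t, ht0, hv, ?_, i, his, ?_, ?_⟩
  · obtain ⟨i', hi', h⟩ := exists_inner_eq_of_isGreatest hf hs hv
    have h1 := hle i' hi'
    exact le_antisymm (inner_le_of_isGreatest hf hs hjs hv) (h ▸ h1)
  · rintro rfl
    rw [hjd] at hid
    exact lt_irrefl _ hid
  · have h1 : t * inner ℝ i d = inner ℝ (j - i) μ := div_mul_cancel₀ _ hid.ne'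
    rw [inner_add_right, real_inner_smul_right, inner_sub_left j i d, hjd]
    linarith

omit hf in
lemma bounded_wulffShape_of_isGreatest : Bornology.IsBounded (wulffShape f) := by
  refine isBounded_iff_forall_norm_le.2 ⟨∑ j ∈ s, ‖j‖, fun x hx => ?_⟩
  by_cases hx0 : x = 0
  · rw [hx0, norm_zero]; positivity
  have h1 := hx _ (norm_inv_smul hx0)
  obtain ⟨j, hj, h2⟩ := (hs _ (norm_inv_smul hx0)).1
  have h3 := real_inner_le_norm j (‖x‖⁻¹ • x)
  rw [norm_inv_smul hx0, mul_one] at h3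
  have h4 : inner ℝ x (‖x‖⁻¹ • x) = ‖x‖ := by
    rw [real_inner_smul_right, real_inner_self_eq_norm_sq]
    have := norm_ne_zero_iff.2 hx0
    field_simp
  rw [h4] at h1
  have h5 : ‖j‖ ≤ ∑ j ∈ s, ‖j‖ := Finset.single_le_sum
    (f := fun j : Plane => ‖j‖) (fun _ _ => norm_nonneg _) hj
  have h6 : inner ℝ j (‖x‖⁻¹ • x) = f (‖x‖⁻¹ • x) := h2
  linarith

omit hs in
lemma zero_mem_wulffShape : (0 : Plane) ∈ wulffShape f := fun ν hν => by
  rw [inner_zero_left]; exact hf.pos_on_sphere ν hν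

/-- The Wulff shape is cut out by the normals orthogonal to differences of generators. -/
lemma wulffShape_eq_of_isGreatest {M : Finset Plane} (hM1 : ∀ ν ∈ M, ‖ν‖ = 1)
    (hM : ∀ i ∈ s, ∀ j ∈ s, i ≠ j → ∀ ν : Plane, ‖ν‖ = 1 → inner ℝ (j - i) ν = 0 → ν ∈ M) :
    wulffShape f = {x | ∀ ν ∈ M, inner ℝ x ν < f ν} := by
  ext z
  refine ⟨fun hz ν hν => hz ν (hM1 ν hν), fun hz μ hμ => ?_⟩
  have hμ0 : μ ≠ 0 := norm_ne_zero_iff.1 (by rw [hμ]; exact one_ne_zero)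
  obtain ⟨j, hj, hjμ⟩ := exists_inner_eq_of_isGreatest hf hs hμ0
  have hd : rot j ≠ 0 := by
    rw [← norm_ne_zero_iff, norm_rot, norm_ne_zero_iff]
    rintro rfl
    rw [inner_zero_left] at hjμ
    exact (hf.pos hμ0).ne hjμ
  have hjd : inner ℝ j (rot j) = 0 := by
    rw [real_inner_comm, inner_rot_left, cross_self]
  have hpos : ∀ v : Plane, v ≠ 0 → inner ℝ j v = f v →
      (∃ i ∈ s, i ≠ j ∧ inner ℝ (j - i) v = 0) → 0 < inner ℝ (j - z) v := by
    rintro v hv hjv ⟨i, hi, hij, h0⟩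
    have h1 : ‖v‖⁻¹ • v ∈ M := by
      refine hM i hi j hj hij _ (norm_inv_smul hv) ?_
      rw [real_inner_smul_right, h0, mul_zero]
    have h2 := hz _ h1
    have h3 := mul_lt_mul_of_pos_left h2 (norm_pos_iff.2 hv)
    rw [← inner_eq_norm_mul z hv, ← hf.eq_norm_mul hv] at h3
    rw [inner_sub_left, hjv]
    linarith
  -- Turning both ways puts `μ` in the cone of two directions where `j` ties with another generator.
  -- Their unit multiples are in `M`, and positivity of `inner ℝ (j - z)` at both passes to `μ`.
  obtain ⟨t₁, ht₁, hv₁, he₁, hi₁⟩ := exists_second_active hf hs hj hμ0 hjμ hd hjd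
  obtain ⟨t₂, ht₂, hv₂, he₂, hi₂⟩ := exists_second_active hf hs hj hμ0 hjμ (neg_ne_zero.2 hd)
    (by rw [inner_neg_right, hjd, neg_zero])
  have h1 := hpos _ hv₁ he₁ hi₁
  have h2 := hpos _ hv₂ he₂ hi₂
  rw [inner_add_right, real_inner_smul_right] at h1 h2
  rw [inner_neg_right] at h2
  have h3 : 0 < inner ℝ (j - z) μ := by
    by_contra hcon
    have h4 := not_lt.1 hcon
    have h5 : 0 < t₁ * inner ℝ (j - z) (rot j) := by linarith
    have h6 : 0 < t₂ * -inner ℝ (j - z) (rot j) := by linarith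
    have h7 := (pos_iff_pos_of_mul_pos h5).1 (ht₁.lt_of_ne' (left_ne_zero_of_mul h5.ne'))
    have h8 := (pos_iff_pos_of_mul_pos h6).1 (ht₂.lt_of_ne' (left_ne_zero_of_mul h6.ne'))
    linarith
  rw [inner_sub_left, hjμ] at h3
  linarith

end WulffShape

/-- The Wulff shape of a crystalline surface tension is a polygon with support numbers `f`. -/
theorem exists_isReducedPolygon_wulffShape {f : Plane → ℝ} (hf : IsSurfaceTension f)
    (hcr : IsCrystalline f) : ∃ N, IsReducedPolygon N f (wulffShape f) := by
  classical
  obtain ⟨s, -, hs⟩ := hcr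
  set M : Finset Plane := ((s ×ˢ s).filter fun p => p.1 ≠ p.2).image fun p =>
    ‖rot (p.1 - p.2)‖⁻¹ • rot (p.1 - p.2) with hM
  have hrot : ∀ i j : Plane, i ≠ j → rot (i - j) ≠ 0 := fun i j hij => by
    rw [← norm_ne_zero_iff, norm_rot, norm_ne_zero_iff]
    exact sub_ne_zero.2 hij
  have hmem : ∀ i ∈ s, ∀ j ∈ s, i ≠ j → ‖rot (i - j)‖⁻¹ • rot (i - j) ∈ M :=
    fun i hi j hj hij => Finset.mem_image.2 ⟨(i, j), Finset.mem_filter.2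
      ⟨Finset.mem_product.2 ⟨hi, hj⟩, hij⟩, rfl⟩
  have hM1 : ∀ ν ∈ M, ‖ν‖ = 1 := by
    intro ν hν
    obtain ⟨p, hp, rfl⟩ := Finset.mem_image.1 hν
    exact norm_inv_smul (hrot _ _ (Finset.mem_filter.1 hp).2)
  have hM2 : ∀ i ∈ s, ∀ j ∈ s, i ≠ j → ∀ ν : Plane, ‖ν‖ = 1 → inner ℝ (j - i) ν = 0 → ν ∈ M := by
    intro i hi j hj hij ν hν h0
    have h1 : cross (‖rot (j - i)‖⁻¹ • rot (j - i)) ν = 0 := by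
      rw [inner_eq] at h0
      simp only [cross, PiLp.smul_apply, smul_eq_mul, rot_zero_apply, rot_one_apply]
      linear_combination (-‖rot (j - i)‖⁻¹) * h0
    rcases eq_or_eq_neg_of_cross_eq_zero (norm_inv_smul (hrot _ _ hij.symm)) hν h1 with h2 | h2
    · rw [h2]; exact hmem j hj i hi hij.symm
    · have h3 : rot (i - j) = -rot (j - i) := plane_ext (by simp) (by simp)
      have h4 := hmem i hi j hj hij
      rwa [h3, norm_neg, smul_neg, ← h2] at h4
  obtain ⟨N, -, hN⟩ := exists_isReducedPolygon_subset hM1 ⟨0, zero_mem_wulffShape hf⟩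
    (bounded_wulffShape_of_isGreatest hs) (wulffShape_eq_of_isGreatest hf hs hM1 hM2)
  exact ⟨N, hN⟩

/-! ### The gauge function -/

section Gauge

variable {f : Plane → ℝ} (hf : IsSurfaceTension f) {N : Finset Plane}
  (hK : IsReducedPolygon N f (wulffShape f))
include hf hK

/-- `K` contains a ball about the origin, so `f` dominates a multiple of the norm and `{f ≤ 1}` is
bounded. Otherwise `sSup` could take its default value. -/
lemma bddAbove_gauge (x : Plane) : BddAbove ((fun ν : Plane => inner ℝ x ν) '' {ν | f ν ≤ 1}) := by
  obtain ⟨ρ, hρ, hsub⟩ := Metric.isOpen_iff.1 hK.isOpen 0 (zero_mem_wulffShape hf)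
  have hlow : ∀ v : Plane, ρ / 2 * ‖v‖ ≤ f v := by
    intro v
    by_cases hv : v = 0
    · rw [hv, norm_zero, mul_zero, hf.map_zero]
    have h1 : (ρ / 2) • (‖v‖⁻¹ • v) ∈ wulffShape f := hsub (by
      rw [mem_ball_zero_iff, norm_smul, norm_inv_smul hv, Real.norm_of_nonneg (by linarith)]
      linarith)
    have h2 := h1 _ (norm_inv_smul hv)
    rw [real_inner_smul_left, real_inner_self_eq_norm_sq, norm_inv_smul hv, one_pow, mul_one] at h2
    rw [hf.eq_norm_mul hv, mul_comm]
    exact mul_le_mul_of_nonneg_left h2.le (norm_nonneg _)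
  refine ⟨‖x‖ * (2 / ρ), ?_⟩
  rintro _ ⟨v, hv, rfl⟩
  have hv : f v ≤ 1 := hv
  have h1 := hlow v
  refine (real_inner_le_norm x v).trans (mul_le_mul_of_nonneg_left ?_ (norm_nonneg _))
  rw [le_div_iff₀ hρ]
  linarith

lemma inner_le_gauge_mul (x : Plane) {ν : Plane} (hν : ‖ν‖ = 1) :
    inner ℝ x ν ≤ gaugeFn f x * f ν := by
  have hpos := hf.pos_on_sphere ν hν
  have h1 : inner ℝ x ((f ν)⁻¹ • ν) ≤ gaugeFn f x := by
    refine le_csSup (bddAbove_gauge hf hK x) ⟨(f ν)⁻¹ • ν, ?_, rfl⟩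
    change f _ ≤ 1
    rw [hf.homogeneous _ _ (inv_pos.2 hpos), inv_mul_cancel₀ hpos.ne']
  rwa [real_inner_smul_right, inv_mul_le_iff₀ hpos, mul_comm] at h1

lemma gauge_le {x : Plane} {l : ℝ} (hl : 0 < l) (h : ∀ μ ∈ N, inner ℝ x μ ≤ l * f μ) :
    gaugeFn f x ≤ l := by
  refine csSup_le ⟨_, 0, by simp [hf.map_zero], rfl⟩ ?_
  rintro _ ⟨v, hv, rfl⟩
  have hv : f v ≤ 1 := hv
  change inner ℝ x v ≤ l
  by_cases hv0 : v = 0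
  · rw [hv0, inner_zero_right]; exact hl.le
  refine le_of_forall_pos_le_add fun ε hε => ?_
  have hlε : 0 < l + ε := by linarith
  have h1 : (l + ε)⁻¹ • x ∈ wulffShape f := by
    rw [hK.mem_iff]
    intro μ hμ
    rw [real_inner_smul_left, inv_mul_lt_iff₀ hlε]
    have := mul_pos hε (hf.pos_on_sphere μ (hK.unit μ hμ))
    linarith [h μ hμ]
  have h2 := h1 _ (norm_inv_smul hv0)
  rw [real_inner_smul_left, inv_mul_lt_iff₀ hlε] at h2
  have h3 := mul_lt_mul_of_pos_left h2 (norm_pos_iff.2 hv0)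
  rw [← inner_eq_norm_mul x hv0] at h3
  have h4 : ‖v‖ * ((l + ε) * f (‖v‖⁻¹ • v)) = (l + ε) * f v := by rw [hf.eq_norm_mul hv0]; ring
  rw [h4] at h3
  have h5 := mul_le_mul_of_nonneg_left hv hlε.le
  linarith

lemma gauge_nonneg (x : Plane) : 0 ≤ gaugeFn f x :=
  le_csSup (bddAbove_gauge hf hK x) ⟨0, by simp [hf.map_zero], by simp⟩

/-- The rescaled point lies in the closed Wulff shape. When the gauge is zero, the convention `0⁻¹ =
0` leaves `f ν`. -/
lemma integrand_nonneg (z : Plane) {ν : Plane} (hν : ‖ν‖ = 1) :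
    0 ≤ f ν - inner ℝ ν ((gaugeFn f z)⁻¹ • z) := by
  rw [real_inner_smul_right, real_inner_comm, sub_nonneg]
  rcases (gauge_nonneg hf hK z).eq_or_lt with h | h
  · rw [← h, inv_zero, zero_mul]; exact hf.nonneg ν
  · rw [inv_mul_le_iff₀ h]; exact inner_le_gauge_mul hf hK z hν

lemma integrand_le (z : Plane) {ν : Plane} (hν : ‖ν‖ = 1) :
    f ν - inner ℝ ν ((gaugeFn f z)⁻¹ • z) ≤ f ν + f (-ν) := by
  have := integrand_nonneg hf hK z (ν := -ν) (by rw [norm_neg, hν])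
  rw [inner_neg_left] at this
  linarith

end Gauge

/-- The oscillation index is bounded by any of the integrals of which it is the infimum. -/
lemma oscillationIndex_sq_le {f : Plane → ℝ} {E : Set Plane} (y : Plane) {c : ℝ} (hc : 0 ≤ c)
    (hn : 0 < normalization f E)
    (h : ∫ x in reducedBoundary E, (f (outerNormal E x) -
      inner ℝ (outerNormal E x) ((gaugeFn f (x - y))⁻¹ • (x - y))) ∂μH[1] ≤ c) :
    oscillationIndex f E ^ 2 ≤ c / normalization f E := by
  have h1 : oscillationIndex f E ≤ √(c / normalization f E) := by
    refine (ciInf_le ⟨0, ?_⟩ y).trans (Real.sqrt_le_sqrt ?_)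
    · rintro _ ⟨y, rfl⟩
      exact Real.sqrt_nonneg _
    · rw [one_div, inv_mul_eq_div]
      exact div_le_div_of_nonneg_right h hn.le
  have h2 : 0 ≤ oscillationIndex f E := Real.iInf_nonneg fun _ => Real.sqrt_nonneg _
  calc oscillationIndex f E ^ 2 ≤ √(c / normalization f E) ^ 2 := by gcongr
    _ = c / normalization f E := Real.sq_sqrt (div_nonneg hc hn.le)

lemma volume_mul_mem_Ioc_le {x : ℝ} (hx : x ≠ 0) (a b : ℝ) :
    volume {s : ℝ | s * x ∈ Ioc a (a + b)} ≤ ENNReal.ofReal (b * |x|⁻¹) := by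
  have h := Real.volume_preimage_mul_right hx (Ioc a (a + b))
  rw [Real.volume_Ioc, add_sub_cancel_left, abs_inv, ← ENNReal.ofReal_mul (by positivity)] at h
  rw [mul_comm]
  exact h.le

/-! ### Oscillation of a polygon close to a translate of the Wulff shape -/

section Estimate

variable {f : Plane → ℝ} (hf : IsSurfaceTension f) {N : Finset Plane}
  (hK : IsReducedPolygon N f (wulffShape f)) {h : Plane → ℝ} {E : Set Plane}
  (hE : IsReducedPolygon N h E)
include hf hK hE

/-- Comparison of the oscillation integral with the integral of a simpler function. -/
lemma setIntegral_integrand_le {G : Plane → Plane → ℝ} (y : Plane)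
    (hG : ∀ ν ∈ N, IntegrableOn (fun x => G x ν) (edge N h ν) μH[1])
    (hle : ∀ ν ∈ N, ∀ x ∈ side N h ν,
      f ν - inner ℝ ν ((gaugeFn f (x - y))⁻¹ • (x - y)) ≤ G x ν) :
    ∫ x in reducedBoundary E, (f (outerNormal E x) -
      inner ℝ (outerNormal E x) ((gaugeFn f (x - y))⁻¹ • (x - y))) ∂μH[1] ≤
      ∑ ν ∈ N, ∫ x in edge N h ν, G x ν ∂μH[1] := by
  rw [← hE.setIntegral_reducedBoundary hG]
  have hmeas : MeasurableSet (reducedBoundary E) := by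
    rw [hE.reducedBoundary_eq]
    exact Finset.measurableSet_biUnion _ fun ν _ => measurableSet_side N h ν
  have hmem : ∀ x ∈ reducedBoundary E, ∃ ν ∈ N, x ∈ side N h ν ∧ outerNormal E x = ν := by
    intro x hx
    rw [hE.reducedBoundary_eq] at hx
    obtain ⟨ν, hν, hxν⟩ := Set.mem_iUnion₂.1 hx
    exact ⟨ν, hν, hxν, hE.outerNormal_eq hν hxν⟩
  -- Nonnegativity of the smaller integrand spares a proof of its integrability.
  refine integral_mono_of_nonneg ?_ ?_ ?_
  · filter_upwards [ae_restrict_mem hmeas] with x hx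
    obtain ⟨ν, hν, -, hn⟩ := hmem x hx
    rw [hn]
    exact integrand_nonneg hf hK _ (hK.unit ν hν)
  · change IntegrableOn _ (reducedBoundary E) _
    rw [hE.reducedBoundary_eq, integrableOn_finset_iUnion]
    intro ν hν
    exact ((hG ν hν).mono_set side_subset_edge).congr_fun
      (fun x hx => by simp only [hE.outerNormal_eq hν hx]) (measurableSet_side N h ν)
  · filter_upwards [ae_restrict_mem hmeas] with x hx
    obtain ⟨ν, hν, hxν, hn⟩ := hmem x hx
    rw [hn]
    exact hle ν hν x hxν

omit hK in
/-- The part of the edge whose radial projection leaves the parallel edge of the Wulff shape. -/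
lemma length_bad_le {y : Plane} {ε A : ℝ} (hε : 0 ≤ ε) (hA : ∀ ν ∈ N, ∀ μ ∈ N, 1 + f μ / f ν ≤ A)
    (hy : ∀ ν ∈ N, |h ν - f ν - inner ℝ y ν| ≤ ε) (hpos : ∀ ν ∈ N, ε < f ν) {ν : Plane}
    (hν : ν ∈ N) : (μH[1] : Measure Plane) (edge N h ν ∩
      {x | ∃ μ ∈ N, (h ν - inner ℝ y ν) / f ν * f μ < inner ℝ (x - y) μ}) ≤
      ∑ μ ∈ N, ENNReal.ofReal (A * ε * |cross ν μ|⁻¹) := by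
  have hν1 := hE.unit ν hν
  have hkν := hf.pos_on_sphere ν hν1
  have hyν := abs_le.1 (hy ν hν)
  have hh : 0 < h ν - inner ℝ y ν := by linarith [hpos ν hν]
  set l := (h ν - inner ℝ y ν) / f ν with hl
  have hlpos : 0 < l := div_pos hh hkν
  have hlν : l * f ν = h ν - inner ℝ y ν := div_mul_cancel₀ _ hkν.ne'
  -- Badness bounds `s * cross ν μ` below by `a μ`. The constraint `μ` of `E` bounds it above by `a
  -- μ + (1 + f μ / f ν) * ε`, so the window has width at most `A * ε`.
  set a := fun μ => l * f μ + inner ℝ y μ - h ν * inner ℝ ν μ with ha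
  have hsub : edge N h ν ∩ {x | ∃ μ ∈ N, l * f μ < inner ℝ (x - y) μ} ⊆
      ⋃ μ ∈ N, linePt h ν '' {s | cross ν μ ≠ 0 ∧ s * cross ν μ ∈ Ioc (a μ) (a μ + A * ε)} := by
    rintro x ⟨⟨hx1, hx2⟩, μ, hμ, hlt⟩
    have hxs := eq_linePt hν1 hx1
    have hin : inner ℝ x μ = h ν * inner ℝ ν μ + cross ν x * cross ν μ := by
      nth_rewrite 1 [hxs]
      exact inner_linePt h ν μ _
    rw [inner_sub_left] at hlt
    have hkμ := hf.pos_on_sphere μ (hE.unit μ hμ)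
    refine Set.mem_iUnion₂.2 ⟨μ, hμ, cross ν x, ⟨fun h0 => ?_, ?_, ?_⟩, hxs.symm⟩
    · rcases eq_or_eq_neg_of_cross_eq_zero hν1 (hE.unit μ hμ) h0 with h1 | h1
      · subst h1
        rw [hx1] at hlt
        linarith
      · subst h1
        rw [inner_neg_right, inner_neg_right, hx1] at hlt
        have := mul_pos hlpos hkμ
        linarith
    · simp only [ha]; linarith
    · have h1 := hx2 μ hμ
      have h2 := (abs_le.1 (hy μ hμ)).2
      have h3 : (1 - ε / f ν) * f μ ≤ l * f μ := by
        refine mul_le_mul_of_nonneg_right ?_ hkμ.le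
        rw [hl, le_div_iff₀ hkν, sub_mul, div_mul_cancel₀ _ hkν.ne']
        linarith
      have h4 := mul_le_mul_of_nonneg_right (hA ν hν μ hμ) hε
      have h5 : (1 - ε / f ν) * f μ = f μ - f μ / f ν * ε := by ring
      simp only [ha]
      linarith
  refine (measure_mono hsub).trans ((measure_biUnion_finset_le _ _).trans ?_)
  refine Finset.sum_le_sum fun μ hμ => ?_
  rw [hausdorff_image_linePt h hν1]
  have hA0 : 0 ≤ A := by
    refine le_trans ?_ (hA ν hν ν hν)
    positivity
  by_cases h0 : cross ν μ = 0
  · simp [h0]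
  · simp only [ne_eq, h0, not_false_eq_true, true_and]
    exact volume_mul_mem_Ioc_le h0 _ _

/-- If the polygon is close to a translate of the Wulff shape then its oscillation is quadratically
small. -/
lemma oscillation_integral_le {y : Plane} {ε A : ℝ} (hε : 0 ≤ ε)
    (hA : ∀ ν ∈ N, ∀ μ ∈ N, 1 + f μ / f ν ≤ A)
    (hy : ∀ ν ∈ N, |h ν - f ν - inner ℝ y ν| ≤ ε) (hpos : ∀ ν ∈ N, ε < f ν) :
    ∫ x in reducedBoundary E, (f (outerNormal E x) -
      inner ℝ (outerNormal E x) ((gaugeFn f (x - y))⁻¹ • (x - y))) ∂μH[1] ≤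
      2 * A ^ 2 * (∑ ν ∈ N, ∑ μ ∈ N, |cross ν μ|⁻¹) * ε ^ 2 := by
  classical
  obtain ⟨ν₀, hν₀⟩ := hE.normals_nonempty
  have hA0 : 0 ≤ A := by
    have := hf.pos_on_sphere ν₀ (hE.unit _ hν₀)
    refine le_trans ?_ (hA ν₀ hν₀ ν₀ hν₀)
    positivity
  set B := fun ν => {x : Plane | ∃ μ ∈ N, (h ν - inner ℝ y ν) / f ν * f μ < inner ℝ (x - y) μ}
    with hB
  have hBm : ∀ ν, MeasurableSet (B ν) := by
    intro ν
    have : B ν = ⋃ μ ∈ N, {x : Plane | (h ν - inner ℝ y ν) / f ν * f μ < inner ℝ (x - y) μ} := by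
      ext x; simp [hB]
    rw [this]
    exact Finset.measurableSet_biUnion _ fun μ _ =>
      (isOpen_lt continuous_const (by fun_prop)).measurableSet
  have hfin : ∀ ν ∈ N, IsFiniteMeasure ((μH[1] : Measure Plane).restrict (edge N h ν)) :=
    fun ν hν => ⟨by simpa using hE.edge_lt_top hν⟩
  refine (setIntegral_integrand_le hf hK hE (G := fun x ν => (B ν).indicator (fun _ => 2 * A * ε) x)
    y ?_ ?_).trans ?_
  · intro ν hν
    have := hfin ν hν
    exact (integrable_const _).indicator (hBm ν)
  · intro ν hν x hx
    have hkν := hf.pos_on_sphere ν (hE.unit ν hν)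
    have hyν := abs_le.1 (hy ν hν)
    have hh : 0 < h ν - inner ℝ y ν := by linarith [hpos ν hν]
    have hxν : inner ℝ (x - y) ν = h ν - inner ℝ y ν := by rw [inner_sub_left, hx.1]
    have hg : 0 < gaugeFn f (x - y) := by
      have h1 := inner_le_gauge_mul hf hK (x - y) (hE.unit ν hν)
      rw [hxν] at h1
      exact pos_of_mul_pos_left (hh.trans_le h1) hkν.le
    -- Any upper bound `l` for the gauge bounds the integrand. Off `B ν` the ratio of the support
    -- numbers makes it zero; on `B ν` the cruder `l = 1 + ε A / f ν` gives `2 A ε`.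
    have key : ∀ l, 0 < l → (∀ μ ∈ N, inner ℝ (x - y) μ ≤ l * f μ) →
        f ν - inner ℝ ν ((gaugeFn f (x - y))⁻¹ • (x - y)) ≤ f ν - l⁻¹ * (h ν - inner ℝ y ν) := by
      intro l hl hle
      rw [real_inner_smul_right, real_inner_comm, hxν]
      have := inv_anti₀ hg (gauge_le hf hK hl hle)
      have := mul_le_mul_of_nonneg_right this hh.le
      linarith
    by_cases hxB : x ∈ B ν
    · rw [Set.indicator_of_mem hxB]
      have hl : 0 < 1 + ε * (f ν)⁻¹ * A := by positivity
      have hle : ∀ μ ∈ N, inner ℝ (x - y) μ ≤ (1 + ε * (f ν)⁻¹ * A) * f μ := by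
        intro μ hμ
        have hkμ := hf.pos_on_sphere μ (hE.unit μ hμ)
        have h1 := (side_subset_edge hx).2 μ hμ
        have h2 := (abs_le.1 (hy μ hμ)).2
        have h3 : f ν ≤ A * f μ := by
          rw [← div_le_iff₀ hkμ]
          linarith [hA μ hμ ν hν]
        have h4 : ε ≤ ε * (f ν)⁻¹ * A * f μ := by
          have := mul_le_mul_of_nonneg_left h3 (mul_nonneg hε (inv_pos.2 hkν).le)
          rw [inv_mul_cancel_right₀ hkν.ne'] at this
          linarith
        rw [inner_sub_left]
        linarith
      have hA1 : 1 ≤ A := by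
        have := hA ν hν ν hν
        rw [div_self hkν.ne'] at this
        linarith
      have h1 := key _ hl hle
      have h2 : f ν - 2 * A * ε ≤ (1 + ε * (f ν)⁻¹ * A)⁻¹ * (h ν - inner ℝ y ν) := by
        rw [le_inv_mul_iff₀ hl]
        have h3 : (1 + ε * (f ν)⁻¹ * A) * (f ν - 2 * A * ε) =
            f ν - A * ε - 2 * (ε * A) ^ 2 * (f ν)⁻¹ := by
          field_simp
          ring
        have h4 : 0 ≤ 2 * (ε * A) ^ 2 * (f ν)⁻¹ := by positivity
        have h5 := mul_le_mul_of_nonneg_right hA1 hε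
        linarith
      linarith
    · rw [Set.indicator_of_notMem hxB]
      have hle : ∀ μ ∈ N, inner ℝ (x - y) μ ≤ (h ν - inner ℝ y ν) / f ν * f μ := by
        intro μ hμ
        by_contra hcon
        exact hxB ⟨μ, hμ, not_le.1 hcon⟩
      have h1 := key _ (div_pos hh hkν) hle
      rw [inv_div, div_mul_cancel₀ _ hh.ne'] at h1
      linarith
  · rw [mul_right_comm (2 * A ^ 2), Finset.mul_sum]
    refine Finset.sum_le_sum fun ν hν => ?_
    have := hfin ν hν
    rw [integral_indicator_const _ (hBm ν), smul_eq_mul, measureReal_restrict_apply (hBm ν),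
      inter_comm]
    have h1 := ENNReal.toReal_mono (by exact (ENNReal.sum_lt_top.2 fun _ _ =>
      ENNReal.ofReal_lt_top).ne) (length_bad_le hf hE hε hA hy hpos hν)
    rw [ENNReal.toReal_sum fun _ _ => ENNReal.ofReal_ne_top] at h1
    have h2 : ∑ μ ∈ N, (ENNReal.ofReal (A * ε * |cross ν μ|⁻¹)).toReal =
        A * ε * ∑ μ ∈ N, |cross ν μ|⁻¹ := by
      rw [Finset.mul_sum]
      exact Finset.sum_congr rfl fun μ _ => ENNReal.toReal_ofReal (by positivity)
    rw [h2] at h1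
    refine (mul_le_mul_of_nonneg_right h1 (by positivity)).trans_eq ?_
    ring

end Estimate

/-! ### Small and large deficit -/

section Stability

variable {f : Plane → ℝ} (hf : IsSurfaceTension f) {N : Finset Plane}
  (hK : IsReducedPolygon N f (wulffShape f)) {σ : Plane → Plane} (hσ : IsCyclicNext N σ)
include hf hK hσ

lemma mixedForm_self_pos : 0 < mixedForm N σ f f := by
  rw [← hK.sum_mul_length hσ]
  exact Finset.sum_pos
    (fun ν hν => mul_pos (hf.pos_on_sphere ν (hK.unit ν hν)) (hK.length_pos hν)) hK.normals_nonempty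

omit hf in
lemma normalization_eq {E : Set Plane} (hvol : volume E = volume (wulffShape f)) :
    normalization f E = mixedForm N σ f f := by
  rw [normalization, measureReal_def, measureReal_def, hvol, ← measureReal_def, mul_assoc,
    Real.mul_self_sqrt measureReal_nonneg, hK.two_mul_volume hσ]

/-- The oscillation integral of any polygon parallel to the Wulff shape is controlled by its
surface energy. -/
lemma oscillation_integral_le_mul_mixedForm {h : Plane → ℝ} {E : Set Plane}
    (hE : IsReducedPolygon N h E) (y : Plane) {D : ℝ} (hD : ∀ ν ∈ N, f ν + f (-ν) ≤ D * f ν) :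
    ∫ x in reducedBoundary E, (f (outerNormal E x) -
      inner ℝ (outerNormal E x) ((gaugeFn f (x - y))⁻¹ • (x - y))) ∂μH[1] ≤
      D * mixedForm N σ h f := by
  refine (setIntegral_integrand_le hf hK hE (G := fun _ ν => D * f ν) y (fun ν hν =>
    hE.integrableOn_edge hν (by fun_prop)) fun ν hν x _ =>
    (integrand_le hf hK _ (hE.unit ν hν)).trans (hD ν hν)).trans_eq ?_
  rw [← hE.sum_mul_length hσ, Finset.mul_sum]
  refine Finset.sum_congr rfl fun ν _ => ?_
  rw [setIntegral_const, smul_eq_mul]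
  ring

end Stability

/-- Quantitative control of the oscillation index of polygons parallel to a polygonal Wulff shape
and of the same area. -/
theorem exists_oscillationIndex_sq_le {f : Plane → ℝ} (hf : IsSurfaceTension f) {N : Finset Plane}
    (hK : IsReducedPolygon N f (wulffShape f)) :
    ∃ C : ℝ, 0 < C ∧ ∀ (h : Plane → ℝ) (E : Set Plane), IsReducedPolygon N h E →
      volume E = volume (wulffShape f) → oscillationIndex f E ^ 2 ≤ C * deficit f E := by
  obtain ⟨σ, hσ⟩ := exists_isCyclicNext hK.unit fun ν hν => hK.exists_cross_pos hν
  have hk : ∀ ν ∈ N, 0 < f ν := fun ν hν => hf.pos_on_sphere ν (hK.unit ν hν)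
  have hk' : ∀ ν ∈ N, 0 ≤ f (-ν) / f ν := fun ν hν => div_nonneg (hf.nonneg _) (hk ν hν).le
  have hV := mixedForm_self_pos hf hK hσ
  obtain ⟨C₁, hC₁, hbound⟩ := exists_translation_bound hσ hK.normals_nonempty hk hV
  set V := mixedForm N σ f f
  obtain ⟨ν₀, hν₀, hmin⟩ := Finset.exists_min_image N f hK.normals_nonempty
  set A := 1 + ∑ ν ∈ N, ∑ μ ∈ N, f μ / f ν
  have hA : ∀ ν ∈ N, ∀ μ ∈ N, 1 + f μ / f ν ≤ A := by
    intro ν hν μ hμ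
    have h0 : ∀ ν ∈ N, ∀ μ ∈ N, 0 ≤ f μ / f ν := fun ν hν μ hμ => (div_pos (hk μ hμ) (hk ν hν)).le
    have h1 := Finset.single_le_sum (f := fun μ => f μ / f ν) (h0 ν hν) hμ
    have h2 := Finset.single_le_sum (f := fun ν => ∑ μ ∈ N, f μ / f ν)
      (fun ν hν => Finset.sum_nonneg (h0 ν hν)) hν
    exact (add_le_add_iff_left 1).2 (h1.trans h2)
  set D := 1 + ∑ ν ∈ N, f (-ν) / f ν with hDdef
  have hD0 : 0 ≤ D := add_nonneg zero_le_one (Finset.sum_nonneg hk')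
  have hD : ∀ ν ∈ N, f ν + f (-ν) ≤ D * f ν := by
    intro ν hν
    have h1 := Finset.single_le_sum hk' hν
    have h2 := (div_le_iff₀ (hk ν hν)).1 h1
    rw [hDdef]
    linarith
  set Q := ∑ ν ∈ N, ∑ μ ∈ N, |cross ν μ|⁻¹
  have hQ : 0 ≤ Q := by positivity
  -- The entry 1 meets the requirement of `hbound`; the other keeps `√(C₁ * δ)` below the minimum `f
  -- ν₀` of `f` on `N`.
  set δ₀ := min 1 (f ν₀ ^ 2 / (4 * C₁))
  have hδ₀ : 0 < δ₀ := lt_min one_pos (by have := hk ν₀ hν₀; positivity)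
  refine ⟨2 * A ^ 2 * Q * C₁ / V + D * (1 + δ₀⁻¹) + 1, by positivity, fun h E hE hvol => ?_⟩
  have hn := normalization_eq hK hσ hvol
  have hn0 : 0 < normalization f E := hn ▸ hV
  have hhh : mixedForm N σ h h = V := by
    rw [← hE.two_mul_volume hσ, measureReal_def, hvol, ← measureReal_def, hK.two_mul_volume hσ]
  set δ := deficit f E with hδ
  have hhf : mixedForm N σ h f = (1 + δ) * V := by
    rw [hδ, deficit, hn, hE.surfaceEnergy_eq hσ, add_sub_cancel, div_mul_cancel₀ _ hV.ne']
  have hδ1 : 0 < 1 + δ := by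
    refine pos_of_mul_pos_left (b := V) ?_ hV.le
    rw [← hhf, ← hE.sum_mul_length hσ]
    exact Finset.sum_pos (fun ν hν => mul_pos (hk ν hν) (hE.length_pos hν)) hE.normals_nonempty
  obtain ⟨hδ0, hy⟩ := hbound h δ hhh hhf hδ1
  rcases le_or_gt δ δ₀ with hle | hgt
  · obtain ⟨y, hy⟩ := hy (hle.trans (min_le_left _ _))
    have hCδ : 0 ≤ C₁ * δ := by positivity
    have hε : √(C₁ * δ) < f ν₀ := by
      rw [Real.sqrt_lt' (hk ν₀ hν₀)]
      have h1 := hle.trans (min_le_right _ _)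
      rw [le_div_iff₀ (by positivity)] at h1
      have := pow_pos (hk ν₀ hν₀) 2
      linarith
    have h1 := oscillationIndex_sq_le y (by positivity) hn0 (oscillation_integral_le hf hK hE
      (y := y) (Real.sqrt_nonneg (C₁ * δ)) hA
      (fun ν hν => Real.abs_le_sqrt (hy ν hν)) fun ν hν => hε.trans_le (hmin ν hν))
    rw [Real.sq_sqrt hCδ, hn] at h1
    have h2 : 0 ≤ (D * (1 + δ₀⁻¹) + 1) * δ := by positivity
    calc _ ≤ _ := h1
      _ = 2 * A ^ 2 * Q * C₁ / V * δ := by ring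
      _ ≤ _ := by linarith
  -- For large deficit any centre serves: β² ≤ D(1 + δ), and 1 ≤ δ₀⁻¹ δ.
  · have h1 := oscillationIndex_sq_le 0 (by rw [hhf]; positivity) hn0
      (oscillation_integral_le_mul_mixedForm hf hK hσ hE 0 hD)
    rw [hn, hhf, ← mul_assoc, mul_div_cancel_right₀ _ hV.ne'] at h1
    have h2 : 1 ≤ δ₀⁻¹ * δ := by
      rw [← inv_mul_cancel₀ hδ₀.ne']
      exact mul_le_mul_of_nonneg_left hgt.le (inv_pos.2 hδ₀).le
    have h3 := mul_le_mul_of_nonneg_left h2 hD0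
    have h4 : 0 ≤ (2 * A ^ 2 * Q * C₁ / V + 1) * δ := by positivity
    linarith

end Wulff

end

theorem proposition5p1 (f : Wulff.Plane → ℝ) (hf : Wulff.IsSurfaceTension f)
    (hcr : Wulff.IsCrystalline f) :
    ∃ C : ℝ, 0 < C ∧ ∀ E : Set Wulff.Plane,
      Wulff.IsParallelTo E (Wulff.wulffShape f) →
      volume E = volume (Wulff.wulffShape f) →
      (volume (symmDiff E (Wulff.wulffShape f)) =
        ⨅ y : Wulff.Plane, volume (symmDiff E ((fun x => x + y) '' Wulff.wulffShape f))) →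
      Wulff.oscillationIndex f E ^ 2 ≤ C * Wulff.deficit f E := by
  obtain ⟨N, hK⟩ := Wulff.exists_isReducedPolygon_wulffShape hf hcr
  obtain ⟨C, hC, hbound⟩ := Wulff.exists_oscillationIndex_sq_le hf hK
  refine ⟨C, hC, fun E hpar hvol _ => ?_⟩
  obtain ⟨N', h, hE⟩ := hpar.1.exists_isReducedPolygon
  -- Equal sets of measure-theoretic normals put `h` and `f` on the same index set.
  obtain rfl : N' = N := Finset.coe_injective (by rw [← hE.normals_eq, hpar.2, hK.normals_eq])
  exact hbound h E hE hvol
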